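/- **Setting.** Let $q$ be a prime power, $d\ge 2$, $n=d-1$, $\mathcal R=\mathbb F_q[x]$, $\tilde{\mathcal K}=\mathbb F_q((x^{-1}))$ with absolute value $|x|=q$, $\|v\|=\max_i|v_i|$ on $\tilde{\mathcal K}^d$, and $\rho(f)=\log_q|f|$. Let $[\mathcal L_d]=\mathrm{PGL}_d(\tilde{\mathcal K})/\mathrm{PGL}_d(\mathcal R)$ be the space of lattices $g\mathcal R^d$ up to homothety, with the quotient topology, let $\ell([g\mathcal R^d])=|\det g|^{-1/d}\min\{\|v\|:0\ne v\in g\mathcal R^d\}$ and $[\mathcal L_d]^{\ge\delta}=\{\mathfrak x:\ell(\mathfrak x)\ge\delta\}$. Let $A_1$ be the group of diagonal matrices $a\in \mathrm{GL}_d(\tilde{\mathcal K})$ with $|\det a|=1$, $[A_1]$ its image in $\mathrm{PGL}_d(\tilde{\mathcal K})$, and $A_1(\mathbf U)$ the subgroup of those $a \in A_1$ all of whose diagonal entries have absolute value $1$. For $a\in A_1$ put $\rho(a)=(\rho(a_1),\dots,\rho(a_d))$ and $\|a\|=\max_i|a_i|$; for $v\in\mathbb R^d$ put $\lceil v\rceil=\max_i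 v_i$. For $\mathfrak x\in[\mathcal L_d]$ let $\Delta_{\mathfrak x}$ be its stabilizer in $A_1$ and $|\Delta_{\mathfrak x}|=[A_1:\Delta_{\mathfrak x}A_1(\mathbf U)]$ its covolume. A *simplex set* is $\Phi=\{t_1,\dots,t_d\}\subset A_1$ with $t_1\cdots t_d=I$ generating a lattice $\Gamma_\Phi=\langle\Phi\rangle$ in $A_1$; it is a simplex set *for* $\mathfrak x$ if $A_1\mathfrak x$ is compact and $\Gamma_\Phi\subseteq\Delta_{\mathfrak x}$. Put $\xi_\Phi=\max_{t\in\Phi}\lceil\rho(t)\rceil$. A simplex set $\Phi$ for $\mathfrak x$ is *$M$-tight* if $\ell(\mathfrak x)\le Mq^{-\frac n2\xi_\Phi}$. It is *$(k,C)$-standard* if $\Phi=\{b_1^kc_1,\dots,b_d^kc_d\}$ with $c_l\in A_1$, $\|c_l\|\le q^C$, where $b_l$ is the diagonal matrix with $l$-th entry $x^{-n}$ and all other entries $x$. For a permutation $\tau$ of $\{1,\dots,n\}$, extended by $\tau(d)=d$, let $w_\tau=\frac1d\sum_{l=1}^d(l-1)\rho(t_{\tau(l)})$, and let $W_\Phi=\{w_\tau\}$.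 A *visit time* (of $\mathfrak x$ to $[\mathcal L_d]^{\ge\delta}$) is $t\in A_1$ with $t\mathfrak x\in[\mathcal L_d]^{\ge\delta}$. Two visit times $t,t'$ are *equivalent* if there are $a_0,\dots,a_m\in A_1$ with $a_0\mathfrak x=t\mathfrak x$, $a_m\mathfrak x=t'\mathfrak x$, all $a_i\mathfrak x\in[\mathcal L_d]^{\ge\delta}$, such that for each $i<m$ one of $a_i\mathfrak x,a_{i+1}\mathfrak x$ is $b$ times the other for some $b\in A_1$ with $\|b\|\le q$; otherwise they are *distinct*. **Theorem.** Fix $q,d$ as above, $M>0$, an integer $C\ge0$, $c>0$, $0<\kappa<1$ and $0<\delta<1$. There is $k_0$ such that for all $k\ge k_0$, every $\mathfrak x_k\in[\mathcal L_d]$ with compact orbit $A_1\mathfrak x_k$, and every $M$-tight, $(k,C)$-standard simplex set $\Phi_k$ for $\mathfrak x_k$, the following holds. Put $\Gamma_k=\langle\Phi_k\rangle$, $W_k=W_{\Phi_k}$, $r=c|\Delta_{\mathfrak x_k}|^{\kappa/n}$, and $$W_k'=\{w\in W_k:\ \exists\, t\in A_1,\ \lceil\rho(t)-w\rceil\le r,\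 t\mathfrak x_k\in[\mathcal L_d]^{\ge\delta}\}.$$ 1. The image of $\Gamma_k$ in $[A_1]$ has finite index, at most $n!$, in the image of $\Delta_{\mathfrak x_k}$. 2. If $W_k'=W_k$, then $\Delta_{\mathfrak x_k}A_1(\mathbf U)=\Gamma_kA_1(\mathbf U)$. 3. If $W_k'=W_k$, then there are at least $n!$ pairwise distinct visit times of $\mathfrak x_k$ to $[\mathcal L_d]^{\ge\delta}$. -/

import Mathlib

open scoped Pointwise

noncomputable section

namespace FuncLattice

/-! ### The local field `𝔽_q((x⁻¹))` -/

/-- The field `𝔽_q((x⁻¹))`: Laurent series over `F` in the variable `x⁻¹`, with the topology of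
the `x⁻¹`-adic valuation (Mathlib's instance on Laurent series). -/
abbrev KInf (F : Type*) [Field F] := LaurentSeries F

/-- The element `x` (the formal variable of the Laurent series being `x⁻¹`). -/
def xElt (F : Type*) [Field F] : KInf F := HahnSeries.single (-1 : ℤ) (1 : F)

/-- The embedding of the polynomial ring `𝔽_q[x]` into `𝔽_q((x⁻¹))`. -/
def polyEmb (F : Type*) [Field F] : Polynomial F →+* KInf F :=
  Polynomial.eval₂RingHom (HahnSeries.C : F →+* KInf F) (xElt F)

section Basic

variable {F : Type*} [Field F]

/-- `log_q |f|` for `f ≠ 0`, an integer. -/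
def rho (f : KInf F) : ℤ := -f.order

lemma xElt_ne_zero : xElt F ≠ 0 := by
  unfold xElt
  exact HahnSeries.single_ne_zero one_ne_zero

variable [Fintype F]

open Classical in
/-- The absolute value on `𝔽_q((x⁻¹))`, with `|x| = q`. -/
def absK (f : KInf F) : ℝ := if f = 0 then 0 else (Fintype.card F : ℝ) ^ rho f

lemma card_pos' : (0 : ℝ) < (Fintype.card F : ℝ) := by
  exact_mod_cast Fintype.card_pos

lemma absK_nonneg (f : KInf F) : 0 ≤ absK f := by
  unfold absK
  split_ifs
  · exact le_rfl
  · exact (zpow_pos card_pos' _).le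

lemma absK_pos {f : KInf F} (hf : f ≠ 0) : 0 < absK f := by
  unfold absK
  rw [if_neg hf]
  exact zpow_pos card_pos' _

@[simp] lemma absK_zero : absK (0 : KInf F) = 0 := by simp [absK]

@[simp] lemma absK_one : absK (1 : KInf F) = 1 := by simp [absK, rho]

lemma absK_mul (f g : KInf F) : absK (f * g) = absK f * absK g := by
  by_cases hf : f = 0
  · simp [hf]
  by_cases hg : g = 0
  · simp [hg]
  unfold absK
  rw [if_neg hf, if_neg hg, if_neg (mul_ne_zero hf hg), ← zpow_add₀ card_pos'.ne']
  congr 1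
  unfold rho
  rw [HahnSeries.order_mul hf hg]
  ring

/-- The absolute value as a multiplicative homomorphism. -/
def absHom : KInf F →*₀ ℝ where
  toFun := absK
  map_zero' := absK_zero
  map_one' := absK_one
  map_mul' := absK_mul

lemma absK_pow (f : KInf F) (k : ℕ) : absK (f ^ k) = absK f ^ k := map_pow absHom f k

lemma absK_zpow (f : KInf F) (k : ℤ) : absK (f ^ k) = absK f ^ k := map_zpow₀ absHom f k

lemma absK_prod {ι : Type*} (s : Finset ι) (f : ι → KInf F) :
    absK (∏ i ∈ s, f i) = ∏ i ∈ s, absK (f i) := map_prod absHom f s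

lemma absK_C {c : F} (hc : c ≠ 0) : absK (HahnSeries.C c : KInf F) = 1 := by
  have h : (HahnSeries.C c : KInf F) ≠ 0 := HahnSeries.C_ne_zero hc
  simp [absK, rho, hc]

lemma absK_polyEmb_unit {p : Polynomial F} (hp : IsUnit p) : absK (polyEmb F p) = 1 := by
  obtain ⟨c, hc, rfl⟩ := Polynomial.isUnit_iff.mp hp
  simp only [polyEmb, Polynomial.coe_eval₂RingHom, Polynomial.eval₂_C]
  exact absK_C hc.ne_zero

/-- The supremum norm `‖v‖ = max_i |v_i|` on `𝔽_q((x⁻¹))^d`. -/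
def supNorm {d : ℕ} (v : Fin d → KInf F) : ℝ := ⨆ i, absK (v i)

lemma supNorm_smul {d : ℕ} (c : KInf F) (v : Fin d → KInf F) :
    supNorm (c • v) = absK c * supNorm v := by
  unfold supNorm
  rw [Real.mul_iSup_of_nonneg (absK_nonneg c)]
  simp [absK_mul]

end Basic

/-! ### The space of lattices up to homothety -/

section Lattices

variable (F : Type*) [Field F] (d : ℕ)

/-- The group `GL_d(𝔽_q((x⁻¹)))`, with its usual topology. -/
abbrev G := GL (Fin d) (KInf F)

/-- The subgroup `GL_d(𝔽_q[x])`. -/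
def GammaR : Subgroup (G F d) :=
  (Matrix.GeneralLinearGroup.map (n := Fin d) (polyEmb F)).range

/-- The stabilizer of the homothety class of the standard lattice `𝔽_q[x]^d`:
the group generated by the scalar matrices and `GL_d(𝔽_q[x])`. -/
def HomStab : Subgroup (G F d) := Subgroup.center (G F d) ⊔ GammaR F d

/-- The space `[L_d] = PGL_d(𝔽_q((x⁻¹))) / PGL_d(𝔽_q[x])` of lattices in `𝔽_q((x⁻¹))^d` up to
homothety, with the quotient topology; the coset of `g` is the class of `g 𝔽_q[x]^d`. -/
abbrev LatSpace := G F d ⧸ HomStab F d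

variable {F d}

/-- The lattice `g 𝔽_q[x]^d`. -/
def latticeOf (g : G F d) : Set (Fin d → KInf F) :=
  Set.range fun p : Fin d → Polynomial F => g.val.mulVec fun i => polyEmb F (p i)

lemma latticeOf_mul_gamma (g : G F d) {γ : G F d} (hγ : γ ∈ GammaR F d) :
    latticeOf (g * γ) = latticeOf g := by
  have key : ∀ (g : G F d) {γ : G F d}, γ ∈ GammaR F d → latticeOf (g * γ) ⊆ latticeOf g := by
    rintro g _ ⟨γ, rfl⟩ _ ⟨p, rfl⟩
    refine ⟨γ.val.mulVec p, ?_⟩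
    dsimp only
    rw [Units.val_mul, ← Matrix.mulVec_mulVec]
    congr 1
    ext1 i
    simp [Matrix.mulVec, dotProduct]
  refine subset_antisymm (key g hγ) ?_
  have h := key (g * γ) (inv_mem hγ)
  rwa [mul_inv_cancel_right] at h

variable [Fintype F]

/-- The normalized length of a shortest non-zero vector of `g 𝔽_q[x]^d`. -/
def ellG (g : G F d) : ℝ :=
  absK g.val.det ^ (-(1 / (d : ℝ))) *
    sInf {s : ℝ | ∃ v ∈ latticeOf g, v ≠ 0 ∧ supNorm v = s}

lemma ellG_mul_gamma (g : G F d) {γ : G F d} (hγ : γ ∈ GammaR F d) :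
    ellG (g * γ) = ellG g := by
  unfold ellG
  rw [latticeOf_mul_gamma g hγ]
  congr 2
  obtain ⟨γ, rfl⟩ := hγ
  rw [Units.val_mul, Matrix.det_mul, absK_mul]
  have h : (Matrix.GeneralLinearGroup.map (polyEmb F) γ).val.det = polyEmb F γ.val.det := by
    rw [RingHom.map_det]
    rfl
  rw [h, absK_polyEmb_unit ((Matrix.isUnit_iff_isUnit_det _).mp γ.isUnit), mul_one]

lemma ellG_mul_center (g : G F d) {z : G F d} (hz : z ∈ Subgroup.center (G F d)) :
    ellG (g * z) = ellG g := by
  rw [Matrix.GeneralLinearGroup.center_eq_range_scalar] at hz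
  obtain ⟨c, rfl⟩ := hz
  rcases Nat.eq_zero_or_pos d with rfl | hd
  · congr 1
    exact Subsingleton.elim _ _
  have hc : (c : KInf F) ≠ 0 := c.ne_zero
  have hval : (g * Matrix.GeneralLinearGroup.scalar (Fin d) c).val = (c : KInf F) • g.val := by
    ext i j
    simp [Matrix.GeneralLinearGroup.scalar, mul_comm]
  have hset : {s : ℝ | ∃ v ∈ latticeOf (g * Matrix.GeneralLinearGroup.scalar (Fin d) c),
      v ≠ 0 ∧ supNorm v = s} =
      absK (c : KInf F) • {s : ℝ | ∃ v ∈ latticeOf g, v ≠ 0 ∧ supNorm v = s} := by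
    ext s
    simp only [Set.mem_smul_set, Set.mem_ofPred_eq, latticeOf, Set.mem_range,
      exists_exists_eq_and, hval, Matrix.smul_mulVec]
    constructor
    · rintro ⟨p, hp, rfl⟩
      exact ⟨_, ⟨p, fun h => hp (by rw [h, smul_zero]), rfl⟩, by rw [supNorm_smul, smul_eq_mul]⟩
    · rintro ⟨_, ⟨p, hp, rfl⟩, rfl⟩
      exact ⟨p, smul_ne_zero hc hp, by rw [supNorm_smul, smul_eq_mul]⟩
  unfold ellG
  rw [hset, Real.sInf_smul_of_nonneg (absK_nonneg _), hval, Matrix.det_smul, absK_mul, absK_pow,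
    Fintype.card_fin, Real.mul_rpow (pow_nonneg (absK_nonneg _) _) (absK_nonneg _),
    ← Real.rpow_natCast, ← Real.rpow_mul (absK_nonneg _)]
  have hd' : (d : ℝ) ≠ 0 := by exact_mod_cast hd.ne'
  have h1 : (d : ℝ) * (-(1 / (d : ℝ))) = -1 := by field_simp
  rw [h1, Real.rpow_neg_one, smul_eq_mul]
  have h2 := (absK_pos hc).ne'
  field_simp

/-- The length `ℓ` of the shortest non-zero vector, on lattices up to homothety:
`ℓ([g 𝔽_q[x]^d]) = |det g|^{-1/d} · min {‖v‖ : 0 ≠ v ∈ g 𝔽_q[x]^d}`. -/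
def ell : LatSpace F d → ℝ :=
  Quotient.lift ellG (by
    intro a b hab
    have h : a⁻¹ * b ∈ HomStab F d := QuotientGroup.leftRel_apply.mp hab
    obtain ⟨z, hz, γ, hγ, h⟩ := Subgroup.mem_sup_of_normal_left.mp h
    have hb : b = a * z * γ := by rw [mul_assoc, h, mul_inv_cancel_left]
    rw [hb, ellG_mul_gamma _ hγ, ellG_mul_center _ hz])

/-- The set `[L_d]^{≥ δ}` of lattice classes with `ℓ ≥ δ`. -/
def LatGe (δ : ℝ) : Set (LatSpace F d) := {x | δ ≤ ell x}

end Lattices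

/-! ### The diagonal group -/

section Diagonal

variable (F : Type*) [Field F] [Fintype F] (d : ℕ)

/-- The group `A₁` of diagonal matrices with determinant of absolute value one. -/
def A1 : Subgroup (G F d) where
  carrier := {g | g.val.IsDiag ∧ absK g.val.det = 1}
  one_mem' := by
    refine ⟨?_, ?_⟩
    · rw [Units.val_one]; exact Matrix.isDiag_one
    · rw [Units.val_one, Matrix.det_one, absK_one]
  mul_mem' := by
    rintro a b ⟨ha, ha'⟩ ⟨hb, hb'⟩
    refine ⟨?_, ?_⟩
    · rw [Units.val_mul, ← ha.diagonal_diag, ← hb.diagonal_diag, Matrix.diagonal_mul_diagonal]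
      exact Matrix.isDiag_diagonal _
    · rw [Units.val_mul, Matrix.det_mul, absK_mul, ha', hb', mul_one]
  inv_mem' := by
    rintro a ⟨ha, ha'⟩
    refine ⟨?_, ?_⟩
    · rw [Matrix.coe_units_inv, ← ha.diagonal_diag, Matrix.inv_diagonal]
      exact Matrix.isDiag_diagonal _
    · have h : absK a.val.det * absK (a⁻¹).val.det = 1 := by
        rw [← absK_mul, ← Matrix.det_mul, ← Units.val_mul, mul_inv_cancel, Units.val_one,
          Matrix.det_one, absK_one]
      rwa [ha', one_mul] at h

variable {F d}

/-- The `i`-th diagonal entry of an element of `A₁`. -/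
def entry (a : A1 F d) (i : Fin d) : KInf F := a.val.val i i

lemma entry_mul (a b : A1 F d) (i : Fin d) : entry (a * b) i = entry a i * entry b i := by
  unfold entry
  rw [Subgroup.coe_mul, Units.val_mul, ← a.2.1.diagonal_diag, ← b.2.1.diagonal_diag,
    Matrix.diagonal_mul_diagonal]
  simp

lemma entry_one (i : Fin d) : entry (1 : A1 F d) i = 1 := by
  simp [entry]

/-- The vector `ρ(a) = (log_q |a_1|, …, log_q |a_d|)`, viewed in `ℝ^d`. -/
def rhoVec (a : A1 F d) (i : Fin d) : ℝ := (rho (entry a i) : ℝ)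

/-- The function `⌈v⌉ = max_i v_i` on `ℝ^d`. -/
def ceil {d : ℕ} (v : Fin d → ℝ) : ℝ := ⨆ i, v i

/-- The group `A₁(U)` of diagonal matrices all of whose entries have absolute value one. -/
def A1U (F : Type*) [Field F] [Fintype F] (d : ℕ) : Subgroup (A1 F d) where
  carrier := {a | ∀ i, absK (entry a i) = 1}
  one_mem' := fun i => by rw [entry_one, absK_one]
  mul_mem' := fun ha hb i => by rw [entry_mul, absK_mul, ha i, hb i, mul_one]
  inv_mem' := by
    intro a ha i
    have h : absK (entry a i) * absK (entry a⁻¹ i) = 1 := by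
      rw [← absK_mul, ← entry_mul, mul_inv_cancel, entry_one, absK_one]
    rwa [ha i, one_mul] at h

/-- The projection of `A₁` to `[A₁] ⊆ PGL_d`, that is, `A₁` modulo homothety. -/
def projA1 (F : Type*) [Field F] [Fintype F] (d : ℕ) :
    A1 F d →* Matrix.ProjGenLinGroup (Fin d) (KInf F) :=
  Matrix.ProjGenLinGroup.mk.comp (A1 F d).subtype

/-- The diagonal matrix with entries `v`, as an element of `A₁`. -/
def diagA1 (v : Fin d → KInf F) (hv : ∏ i, absK (v i) = 1) : A1 F d :=
  ⟨Matrix.GeneralLinearGroup.mkOfDetNeZero (Matrix.diagonal v) (by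
      intro h
      rw [Matrix.det_diagonal] at h
      rw [← absK_prod, h, absK_zero] at hv
      exact zero_ne_one hv),
    Matrix.isDiag_diagonal v, by
      change absK (Matrix.diagonal v).det = 1
      rw [Matrix.det_diagonal, absK_prod, hv]⟩

/-- The stabilizer `Δ_x` of `x` in `A₁`. -/
abbrev stab (x : LatSpace F d) : Subgroup (A1 F d) := MulAction.stabilizer (A1 F d) x

/-- `|Δ_x|`, the covolume of `Δ_x` for the Haar measure of `[A₁]` giving mass one to the image of
`A₁(U)`: the index of `ρ(Δ_x)` in `ρ(A₁) = ℤ^d_0`, that is, of `Δ_x A₁(U)` in `A₁`. -/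
def covol (x : LatSpace F d) : ℕ := (stab x ⊔ A1U F d).index

/-- `x ∈ Ω`: the orbit `A₁ x` is compact. -/
def InOmega (x : LatSpace F d) : Prop := IsCompact (MulAction.orbit (A1 F d) x)

/-! ### Visit times -/

/-- `t` is a visit time of the orbit of `x` to `[L_d]^{≥ δ}`. -/
def IsVisit (δ : ℝ) (x : LatSpace F d) (t : A1 F d) : Prop := t • x ∈ LatGe δ

/-- `y` and `y'` are at distance at most `q` along an `A₁`-orbit: one of them is the translate of
the other by some `b ∈ A₁` with `‖b‖ = max_i |b_i| ≤ q` (equivalently, `‖b - I‖ ≤ q`). -/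
def OrbitStep (y y' : LatSpace F d) : Prop :=
  ∃ b : A1 F d, supNorm (entry b) ≤ Fintype.card F ∧ (b • y = y' ∨ b • y' = y)

/-- Visit times `t₁`, `t₂` are equivalent if a path `a_0 x = t₁ x, a_1 x, …, a_m x = t₂ x` inside
`[L_d]^{≥ δ}` joins them, with consecutive points at distance at most `q` along the orbit. -/
def EquivVisit (δ : ℝ) (x : LatSpace F d) (t₁ t₂ : A1 F d) : Prop :=
  ∃ (m : ℕ) (a : ℕ → A1 F d), a 0 • x = t₁ • x ∧ a m • x = t₂ • x ∧
    (∀ i ≤ m, a i • x ∈ LatGe δ) ∧ ∀ i < m, OrbitStep (a i • x) (a (i + 1) • x)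

end Diagonal

/-! ### Simplex sets, in dimension `d = n + 1` -/

section Simplex

variable {F : Type*} [Field F] [Fintype F] {n : ℕ}

/-- The group `Γ_Φ` generated by `Φ = {t_1, …, t_d}`. -/
def genGroup (t : Fin (n + 1) → A1 F (n + 1)) : Subgroup (A1 F (n + 1)) :=
  Subgroup.closure (Set.range t)

/-- `Φ = {t_1, …, t_d}` is a simplex set: `Γ_Φ` is a lattice in `A₁` (a discrete, cocompact
subgroup of this abelian group) and `t_1 ⋯ t_d = I`. The product is taken in the order of the
indices; `A₁` is commutative. -/
def IsSimplexSet (t : Fin (n + 1) → A1 F (n + 1)) : Prop :=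
  DiscreteTopology (genGroup t) ∧ CompactSpace (A1 F (n + 1) ⧸ genGroup t) ∧
    (List.ofFn t).prod = 1

/-- `Φ` is a simplex set for the lattice class `x`. -/
def IsSimplexSetFor (t : Fin (n + 1) → A1 F (n + 1)) (x : LatSpace F (n + 1)) : Prop :=
  IsSimplexSet t ∧ genGroup t ≤ stab x

/-- `ξ_Φ = max_{t ∈ Φ} ⌈ρ(t)⌉`. -/
def xi (t : Fin (n + 1) → A1 F (n + 1)) : ℝ := ⨆ l, ceil (rhoVec (t l))

/-- `Φ` is an `M`-tight simplex set for `x ∈ Ω`: `ℓ(x) ≤ M q^{-(n/2) ξ_Φ}`. -/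
def IsTight (M : ℝ) (t : Fin (n + 1) → A1 F (n + 1)) (x : LatSpace F (n + 1)) : Prop :=
  InOmega x ∧ IsSimplexSetFor t x ∧
    ell x ≤ M * (Fintype.card F : ℝ) ^ (-((n : ℝ) / 2) * xi t)

lemma prod_stdVec (l : Fin (n + 1)) :
    ∏ i, absK (if i = l then xElt F ^ (-(n : ℤ)) else xElt F) = 1 := by
  have hx := (absK_pos (xElt_ne_zero (F := F))).ne'
  rw [Fin.prod_univ_succAbove _ l]
  simp only [if_true, Fin.succAbove_ne, if_false, Finset.prod_const, Finset.card_univ,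
    Fintype.card_fin, absK_zpow]
  rw [zpow_neg, zpow_natCast, inv_mul_cancel₀ (pow_ne_zero _ hx)]

/-- The diagonal matrix `b_l` with entry `x^{-n}` at `l` and `x` elsewhere. -/
def stdVec (F : Type*) [Field F] [Fintype F] {n : ℕ} (l : Fin (n + 1)) : A1 F (n + 1) :=
  diagA1 (fun i => if i = l then xElt F ^ (-(n : ℤ)) else xElt F) (prod_stdVec l)

/-- `Φ` is `(k, C)`-standard: `Φ = {b_1^k c_1, …, b_d^k c_d}` with `c_l ∈ A₁`, `‖c_l‖ ≤ q^C`. -/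
def IsStandard (k C : ℕ) (t : Fin (n + 1) → A1 F (n + 1)) : Prop :=
  ∃ c : Fin (n + 1) → A1 F (n + 1),
    (∀ l, supNorm (entry (c l)) ≤ (Fintype.card F : ℝ) ^ C) ∧
    Set.range t = Set.range fun l => stdVec F l ^ k * c l

/-- A permutation of `n` elements acting on the `d = n + 1` indices, the last one being fixed. -/
def extPerm (τ : Equiv.Perm (Fin n)) : Fin (n + 1) → Fin (n + 1) :=
  Fin.lastCases (Fin.last n) fun i => (τ i).castSucc

/-- `w_τ = (1/d) ∑_l (l - 1) ρ(t_{τ(l)})`; the index `l` starts from `0` here. -/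
def wVec (t : Fin (n + 1) → A1 F (n + 1)) (τ : Equiv.Perm (Fin n)) : Fin (n + 1) → ℝ :=
  fun i => (1 / ((n : ℝ) + 1)) * ∑ l : Fin (n + 1), (l : ℝ) * rhoVec (t (extPerm τ l)) i

/-- The set `W_Φ = {w_τ}`, with `τ` running over the permutations of `n` elements. -/
def WSet (t : Fin (n + 1) → A1 F (n + 1)) : Set (Fin (n + 1) → ℝ) := Set.range (wVec t)

/-- The radius `r = c |Δ_x|^{κ/n}`. -/
def radius (c κ : ℝ) (x : LatSpace F (n + 1)) : ℝ := c * (covol x : ℝ) ^ (κ / n)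

/-- The preimage `ρ⁻¹(B_r(w)) = {a ∈ A₁ : ⌈ρ(a) - w⌉ ≤ r}`. -/
def rhoBall (r : ℝ) (w : Fin (n + 1) → ℝ) : Set (A1 F (n + 1)) :=
  {a | ceil (rhoVec a - w) ≤ r}

/-- The set `W'` of those `w ∈ W_Φ` such that `ρ⁻¹(B_r(w))` contains a visit time of `x` to
`[L_d]^{≥ δ}`, where `r = c |Δ_x|^{κ/n}`. -/
def WVisited (c κ δ : ℝ) (t : Fin (n + 1) → A1 F (n + 1)) (x : LatSpace F (n + 1)) :
    Set (Fin (n + 1) → ℝ) :=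
  {w | w ∈ WSet t ∧ ∃ a ∈ rhoBall (radius c κ x) w, IsVisit δ x a}

end Simplex

end FuncLattice

end

open FuncLattice

namespace FuncLattice

/-! ### Nearly standard simplex lattices in `ℤ^d` -/

section Combinatorics

variable {n : ℕ}

/-! Apply `ρ` and work in the integer vectors of coordinate sum zero. The image of `Γ_Φ` is spanned
by vectors within a bounded distance of `k (1, …, 1, -n, 1, …, 1)`, so it is a slightly perturbed
multiple of the lattice dual to the root lattice `A_n`. Its Voronoi cell is nearly a permutohedron,
whose vertices fall into `n!` classes modulo the lattice; they are the deep holes for `⌈·⌉`, and the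
`w_τ` lie near one representative of each class.

Tightness turns visits into deep holes. If `v` is a shortest vector of `x`, then for each `γ` in the
stabilizer `aγv` is, up to a unit scalar, a vector of `a x` of norm at most `q^{⌈ρ(aγ)⌉} ‖v‖`. A
visit at `a` therefore forces `⌈ρ(a) + ρ(γ)⌉ ≥ nk/2 - O(1)` for every `γ`. Every point can be moved
by the lattice to where `⌈·⌉ ≤ nk/2 + O(1)` (`NearStd.reduce`), and only points near deep holes
cannot be moved lower (`NearStd.near_hole`, `TightData.near_of_isVisit`).

Tightness also gives rigidity (`TightData.entry_eq_of_small`). The images of `v` under `1, b_0, b_0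
b_1, …` are independent, and by Hadamard their determinant is as small as the covolume permits, up
to a bounded factor. Exchanging one of them, other than `v`, for the image of `v` under a
stabilizing element of size at most `q^{k/2}` would make the determinant too small, so every such
element is scalar.

For the index bound, some `a` is a visit at a depth depending only on `n`
(`TightData.exists_visit`). The visits `a s`, with `s` in the stabilizer, lie near the `n!` holes
modulo `Γ_Φ`; two near the same hole differ by `Γ_Φ` and a small, hence scalar, element. If every
hole is visited, the stabilizer permutes the set of holes modulo `Γ_Φ`; no nonzero translation
modulo the lattice does this, so `ρ(Δ_x) = ρ(Γ_Φ)` (`TightData.exists_mul_rhoZ_eq_zero`). Finally `r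
= O(k^κ)` is negligible against the distance of order `k` between holes, and a chain of bounded
steps through visits cannot jump from one hole to another (`TightData.eq_of_equivVisit`). -/

/-- The integer combination `∑ m_j u_j`. -/
def lin (u : Fin (n + 1) → Fin (n + 1) → ℤ) (m : Fin (n + 1) → ℤ) : Fin (n + 1) → ℤ :=
  fun i => ∑ j, m j * u j i

/-- The vectors `u_j` are at distance at most `E` from `k (1, …, 1, -n, 1, …, 1)`, have vanishing
coordinate sum, and add up to zero. -/
structure NearStd (k E : ℤ) (u : Fin (n + 1) → Fin (n + 1) → ℤ) : Prop where
  close : ∀ j i, |u j i - (k - if i = j then (n + 1) * k else 0)| ≤ E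
  sum_coord : ∀ j, ∑ i, u j i = 0
  sum_vec : ∀ i, ∑ j, u j i = 0

/-- `2 z` is at distance at most `D` from twice the vertex `k (n / 2 - p i)_i` of the
permutohedron. -/
def Near (k : ℤ) (z : Fin (n + 1) → ℤ) (p : Equiv.Perm (Fin (n + 1))) (D : ℤ) : Prop :=
  ∀ i, |2 * z i - k * (n - 2 * ((p i : ℕ) : ℤ))| ≤ D

lemma lin_add (u : Fin (n + 1) → Fin (n + 1) → ℤ) (m m' : Fin (n + 1) → ℤ) :
    lin u (m + m') = lin u m + lin u m' := by
  ext i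
  simp [lin, add_mul, Finset.sum_add_distrib]

lemma lin_single (u : Fin (n + 1) → Fin (n + 1) → ℤ) (j : Fin (n + 1)) :
    lin u (Pi.single j 1) = u j := by
  ext i
  simp [lin, Pi.single_apply]

lemma NearStd.sum_lin {k E : ℤ} {u : Fin (n + 1) → Fin (n + 1) → ℤ} (hu : NearStd k E u)
    (m : Fin (n + 1) → ℤ) : ∑ i, lin u m i = 0 := by
  unfold lin
  rw [Finset.sum_comm]
  simp [← Finset.mul_sum, hu.sum_coord]

/-- The error grows with the `ℓ¹`-norm of the coefficients, so each application has to bound these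
first. -/
lemma NearStd.lin_close {k E : ℤ} {u : Fin (n + 1) → Fin (n + 1) → ℤ} (hu : NearStd k E u)
    (m : Fin (n + 1) → ℤ) (i : Fin (n + 1)) :
    |lin u m i - k * (∑ j, m j - (n + 1) * m i)| ≤ E * ∑ j, |m j| := by
  have h : lin u m i - k * (∑ j, m j - (n + 1) * m i) =
      ∑ j, m j * (u j i - (k - if i = j then (n + 1) * k else 0)) := by
    have h1 : ∑ j, m j * (if i = j then ((n : ℤ) + 1) * k else 0) = m i * ((n + 1) * k) := by
      simp
    simp only [lin, mul_sub, Finset.sum_sub_distrib, h1, ← Finset.sum_mul]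
    ring
  rw [h, Finset.mul_sum]
  refine (Finset.abs_sum_le_sum_abs _ _).trans (Finset.sum_le_sum fun j _ => ?_)
  rw [abs_mul, mul_comm]
  exact mul_le_mul_of_nonneg_right (hu.close j i) (abs_nonneg _)

lemma NearStd.nonneg {k E : ℤ} {u : Fin (n + 1) → Fin (n + 1) → ℤ} (hu : NearStd k E u) :
    0 ≤ E := (abs_nonneg _).trans (hu.close 0 0)

/-- A coordinate-sum-zero vector bounded above by `Z` has `ℓ¹`-norm at most `2 d Z`. -/
lemma sum_abs_le_of_le {z : Fin (n + 1) → ℤ} (hz : ∑ i, z i = 0) {Z : ℤ} (hZ : ∀ i, z i ≤ Z)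
    (hZ0 : 0 ≤ Z) : ∑ i, |z i| ≤ 2 * ((n + 1) * Z) := by
  have h : ∑ i, |z i| = ∑ i, (|z i| + z i) := by rw [Finset.sum_add_distrib, hz, add_zero]
  rw [h]
  have h2 : ∀ i ∈ Finset.univ, |z i| + z i ≤ 2 * Z := by
    intro i _
    rcases abs_cases (z i) with ⟨h, _⟩ | ⟨h, _⟩ <;> rw [h] <;> linarith [hZ i]
  refine (Finset.sum_le_card_nsmul _ _ _ h2).trans (le_of_eq ?_)
  simp
  ring

lemma NearStd.sq_sum_le {k E : ℤ} {u : Fin (n + 1) → Fin (n + 1) → ℤ} (hu : NearStd k E u)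
    (hk : 0 ≤ k) (j : Fin (n + 1)) :
    ∑ i, u j i ^ 2 ≤ n * (n + 1) * k ^ 2 + 4 * n * k * E + (n + 1) * E ^ 2 := by
  have hE := hu.nonneg
  rw [Fin.sum_univ_succAbove _ j]
  have h1 : u j j ^ 2 ≤ (n * k + E) ^ 2 := by
    have h := abs_le.mp (hu.close j j)
    simp only [if_true] at h
    have : (0 : ℤ) ≤ n * k := by positivity
    exact sq_le_sq' (by nlinarith) (by nlinarith)
  have h2 : ∀ i ∈ Finset.univ, u j (j.succAbove i) ^ 2 ≤ (k + E) ^ 2 := by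
    intro i _
    have h := abs_le.mp (hu.close j (j.succAbove i))
    simp only [Fin.succAbove_ne, if_false] at h
    exact sq_le_sq' (by nlinarith) (by nlinarith)
  have h3 := Finset.sum_le_card_nsmul _ _ _ h2
  simp only [Finset.card_univ, Fintype.card_fin, nsmul_eq_mul] at h3
  nlinarith

/-- Every vector can be moved by the lattice to one whose coordinates exceed `n k / 2` by a bounded
amount only. -/
lemma NearStd.reduce {k E : ℤ} {u : Fin (n + 1) → Fin (n + 1) → ℤ} (hu : NearStd k E u)
    (hk : 8 * (n + 3) * (E + 1) ≤ k) (z : Fin (n + 1) → ℤ) (hz : ∑ i, z i = 0) :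
    ∃ m, ∀ i, 2 * (z + lin u m) i ≤ n * k + 2 * (n + 3) * (E + 1) := by
  have hE := hu.nonneg
  -- Take a translate of least Euclidean length. The minimum exists because the squared lengths are
  -- natural numbers.
  obtain ⟨m, hm⟩ : ∃ m : Fin (n + 1) → ℤ, ∀ m', ∑ i, (z + lin u m) i ^ 2 ≤
      ∑ i, (z + lin u m') i ^ 2 := by
    let f : (Fin (n + 1) → ℤ) → ℕ := fun m => (∑ i, (z + lin u m) i ^ 2).toNat
    have hf : ∀ m, (f m : ℤ) = ∑ i, (z + lin u m) i ^ 2 := fun m =>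
      Int.toNat_of_nonneg (Finset.sum_nonneg fun i _ => sq_nonneg _)
    refine ⟨Function.argmin f, fun m' => ?_⟩
    rw [← hf, ← hf]
    exact_mod_cast Function.argmin_le f m'
  refine ⟨m, ?_⟩
  set y := z + lin u m with hy
  have hysum : ∑ i, y i = 0 := by
    simp [hy, Finset.sum_add_distrib, hz, hu.sum_lin]
  obtain ⟨j, -, hj⟩ := Finset.exists_max_image Finset.univ y ⟨0, Finset.mem_univ _⟩
  have hj' : ∀ i, y i ≤ y j := fun i => hj i (Finset.mem_univ i)
  have hj0 : 0 ≤ y j := by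
    by_contra h
    push Not at h
    have : ∑ i, y i < 0 := Finset.sum_neg (fun i _ => (hj' i).trans_lt h) ⟨0, Finset.mem_univ _⟩
    omega
  have hn0 : (0 : ℤ) ≤ n := by positivity
  have hk0 : 0 ≤ k := le_trans (by positivity) hk
  -- Minimality is tested against `u_j`, with `y_j` the largest coordinate: `2⟨y, u_j⟩ + |u_j|² ≥
  -- 0`. As `⟨y, u_j⟩ ≈ -(n+1) k y_j` and `|u_j|² ≈ n (n+1) k²`, this says `2 y_j ≤ n k` up to a
  -- bounded error.
  have hmin := hm (m + Pi.single j 1)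
  rw [lin_add, lin_single, ← add_assoc, ← hy] at hmin
  have hexp : ∑ i, (y + u j) i ^ 2 = ∑ i, y i ^ 2 + 2 * ∑ i, y i * u j i + ∑ i, u j i ^ 2 := by
    rw [Finset.mul_sum, ← Finset.sum_add_distrib, ← Finset.sum_add_distrib]
    refine Finset.sum_congr rfl fun i _ => ?_
    simp only [Pi.add_apply]
    ring
  have hcross : ∑ i, y i * u j i ≤ -((n + 1) * k * y j) + E * ∑ i, |y i| := by
    have h1 : ∑ i, y i * u j i = -((n + 1) * k * y j) +
        ∑ i, y i * (u j i - (k - if i = j then (n + 1) * k else 0)) := by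
      have h1 : ∑ i, y i * (if i = j then ((n : ℤ) + 1) * k else 0) = y j * ((n + 1) * k) := by
        simp
      simp only [mul_sub, Finset.sum_sub_distrib, h1, ← Finset.sum_mul, hysum]
      ring
    rw [h1, Finset.mul_sum]
    refine add_le_add le_rfl (Finset.sum_le_sum fun i _ => ?_)
    calc y i * (u j i - (k - if i = j then (n + 1) * k else 0))
        ≤ |y i| * |u j i - (k - if i = j then (n + 1) * k else 0)| := by
          rw [← abs_mul]; exact le_abs_self _
      _ ≤ |y i| * E := mul_le_mul_of_nonneg_left (hu.close j i) (abs_nonneg _)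
      _ = E * |y i| := mul_comm _ _
  have habs := sum_abs_le_of_le hysum hj' hj0
  have hsq := hu.sq_sum_le hk0 j
  have hmain : 2 * ((n + 1) * k * y j) ≤ 4 * (n + 1) * E * y j +
      (n * (n + 1) * k ^ 2 + 4 * n * k * E + (n + 1) * E ^ 2) := by
    have := mul_le_mul_of_nonneg_left habs hE
    nlinarith
  have hmain2 : 2 * k * y j ≤ 4 * E * y j + n * k ^ 2 + 4 * k * E + E ^ 2 := by
    have hd : (0 : ℤ) < n + 1 := by positivity
    refine le_of_mul_le_mul_left ?_ hd
    have : 0 ≤ 4 * k * E := by positivity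
    nlinarith
  intro i
  have hfin : 2 * y j ≤ n * k + 2 * (n + 3) * (E + 1) := by
    by_contra hcon
    push Not at hcon
    have hkE : 0 ≤ k - 2 * E := by nlinarith
    have h1 : (k - 2 * E) * (n * k + 2 * (n + 3) * (E + 1)) ≤ (k - 2 * E) * (2 * y j) :=
      mul_le_mul_of_nonneg_left hcon.le hkE
    have h2 : (k - 2 * E) * (2 * y j) ≤ n * k ^ 2 + 4 * k * E + E ^ 2 := by linarith
    have h3 : k * (2 * E + 6 + 2 * n) ≤ E ^ 2 + 4 * E * (n + 3) * (E + 1) := by linarith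
    have h4 : (8 * (n + 3) * (E + 1)) * (2 * E + 6 + 2 * n) ≤ k * (2 * E + 6 + 2 * n) :=
      mul_le_mul_of_nonneg_right hk (by positivity)
    have h5 : 0 ≤ n * E := by positivity
    have h6 : 0 ≤ n * E * E := by positivity
    have h7 : 0 ≤ n * n * E := by positivity
    nlinarith
  linarith [hj' i]

/-- Lattice elements that move a bounded multiple of `k` back to almost zero do so exactly. -/
lemma NearStd.exact {k E : ℤ} {u : Fin (n + 1) → Fin (n + 1) → ℤ} (hu : NearStd k E u)
    {Y : ℤ} (hY : 0 ≤ Y) (hk : 2 * (2 * Y + 1) * E + 2 * E + 1 ≤ k) (y m : Fin (n + 1) → ℤ)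
    (hy : ∀ i, |y i| ≤ Y) (h : ∀ i, 2 * |k * y i + lin u m i| ≤ k) :
    ∃ m' : Fin (n + 1) → ℤ, lin u m' = lin u m ∧
      ∀ i, y i + ∑ j, m' j - (n + 1) * m' i = 0 := by
  have hE := hu.nonneg
  -- Because the `u_j` add up to zero, the least coefficient can be subtracted from all. The
  -- coefficients become nonnegative with a zero at `l`, and their `ℓ¹`-norm is their sum `S`.
  obtain ⟨l, -, hl⟩ := Finset.exists_min_image Finset.univ m ⟨0, Finset.mem_univ _⟩
  have hlin : lin u (fun j => m j - m l) = lin u m := by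
    ext i
    simp [lin, sub_mul, Finset.sum_sub_distrib, ← Finset.mul_sum, hu.sum_vec]
  refine ⟨fun j => m j - m l, hlin, ?_⟩
  set m' : Fin (n + 1) → ℤ := fun j => m j - m l with hm'
  have hpos : ∀ j, 0 ≤ m' j := fun j => sub_nonneg.mpr (hl j (Finset.mem_univ j))
  have hl0 : m' l = 0 := sub_self _
  have habs : ∑ j, |m' j| = ∑ j, m' j := Finset.sum_congr rfl fun j _ => abs_of_nonneg (hpos j)
  have hclose := hu.lin_close m'
  rw [habs, hlin] at hclose
  set S := ∑ j, m' j with hS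
  have hS0 : 0 ≤ S := Finset.sum_nonneg fun j _ => hpos j
  have hkpos : 0 < k := by nlinarith [mul_nonneg hY hE]
  -- At the coordinate `l` the combination is about `k S`, and only `k y_l`, of size at most `k Y`,
  -- is there to cancel it.
  have hSle : S ≤ 2 * Y + 1 := by
    have h1 := abs_le.mp (hclose l)
    have h2 := abs_le.mp (hy l)
    have h3 := (abs_le.mp (le_refl |k * y l + lin u m l|)).2
    have h4 := h l
    rw [hl0] at h1
    have h5 : 2 * (k - E) * S ≤ k * (2 * Y + 1) := by nlinarith
    by_contra hcon
    push Not at hcon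
    have h6 : k * S ≤ 2 * (k - E) * S := by nlinarith
    nlinarith
  intro i
  have h1 := abs_le.mp (hclose i)
  have h3 := abs_le.mp (le_refl |k * y i + lin u m i|)
  have h4 := h i
  have h5 : E * S ≤ E * (2 * Y + 1) := mul_le_mul_of_nonneg_left hSle hE
  -- The accumulated error `E S` is now below `k/2`, so `k` times the integer in question is smaller
  -- than `k` in absolute value.
  have h6 : 2 * (k * (y i + S - (n + 1) * m' i)) < 2 * k := by nlinarith
  have h7 : -(2 * k) < 2 * (k * (y i + S - (n + 1) * m' i)) := by nlinarith
  have h8 : y i + S - (n + 1) * m' i < 1 := by nlinarith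
  have h9 : -1 < y i + S - (n + 1) * m' i := by nlinarith
  omega

/-- Distinct normalized vertices stay apart modulo the lattice. -/
lemma NearStd.separate {k E : ℤ} {u : Fin (n + 1) → Fin (n + 1) → ℤ} (hu : NearStd k E u)
    (hk : 2 * (2 * n + 1) * E + 2 * E + 1 ≤ k) {p p' : Equiv.Perm (Fin (n + 1))}
    {i₀ : Fin (n + 1)} (hp : p i₀ = p' i₀) {z z' m : Fin (n + 1) → ℤ} {D D' : ℤ}
    (hz : Near k z p D) (hz' : Near k z' p' D') (hm : z' = z + lin u m) (hD : D + D' ≤ k) :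
    p = p' ∧ z' = z := by
  have hpv : ∀ (p : Equiv.Perm (Fin (n + 1))) i, ((p i : ℕ) : ℤ) ≤ n := fun p i => by
    have := (p i).is_lt
    omega
  obtain ⟨m', hm', hex⟩ := hu.exact (Y := n) (by positivity) hk
    (fun i => ((p' i : ℕ) : ℤ) - ((p i : ℕ) : ℤ)) m
    (fun i => abs_le.mpr ⟨by have := hpv p i; omega, by have := hpv p' i; omega⟩) (by
      intro i
      have h1 := abs_le.mp (hz i)
      have h2 := abs_le.mp (hz' i)
      have h3 : z' i = z i + lin u m i := by rw [hm]; rfl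
      have h4 : |k * (((p' i : ℕ) : ℤ) - ((p i : ℕ) : ℤ)) + lin u m i| * 2 ≤ k := by
        rw [← abs_two, ← abs_mul, abs_le]
        constructor <;> linarith
      linarith)
  -- The normalization at `i₀` gives `∑ m'_j = (n+1) m'_{i₀}`. Hence each `p' i - p i` is a multiple
  -- of `n + 1` of size at most `n`, that is, zero.
  have h0 := hex i₀
  rw [hp] at h0
  have hconst : ∀ i, p i = p' i ∧ m' i = m' i₀ := by
    intro i
    have h1 := hex i
    have h2 : ((p' i : ℕ) : ℤ) - ((p i : ℕ) : ℤ) = (n + 1) * (m' i - m' i₀) := by linarith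
    have h3 : m' i - m' i₀ = 0 := by
      have h4 : ((n : ℤ) + 1) * (m' i - m' i₀) ≤ n := by
        have := hpv p' i; omega
      have h5 : -(n : ℤ) ≤ ((n : ℤ) + 1) * (m' i - m' i₀) := by
        have := hpv p i; omega
      have h6 : m' i - m' i₀ < 1 := by nlinarith
      have h7 : -1 < m' i - m' i₀ := by nlinarith
      omega
    rw [h3] at h2
    exact ⟨Fin.ext (by omega), by omega⟩
  refine ⟨Equiv.ext fun i => (hconst i).1, ?_⟩
  have hlin0 : lin u m = 0 := by
    rw [← hm']
    ext i
    simp only [lin, Pi.zero_apply]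
    rw [Finset.sum_congr rfl fun j _ => by rw [(hconst j).2], ← Finset.mul_sum, hu.sum_vec,
      mul_zero]
  rw [hm, hlin0, add_zero]

lemma sum_perm_val (p : Equiv.Perm (Fin (n + 1))) :
    ∑ i, ((n : ℤ) - 2 * ((p i : ℕ) : ℤ)) = 0 := by
  rw [Equiv.sum_comp p (fun i => (n : ℤ) - 2 * ((i : ℕ) : ℤ)), Finset.sum_sub_distrib,
    ← Finset.mul_sum]
  have h : ∑ i : Fin (n + 1), ((i : ℕ) : ℤ) * 2 = (n + 1) * n := by
    rw [Fin.sum_univ_eq_sum_range (fun i => (i : ℤ) * 2), ← Finset.sum_mul]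
    have := Finset.sum_range_id_mul_two (n + 1)
    simp only [Nat.add_sub_cancel] at this
    have := congrArg (Nat.cast : ℕ → ℤ) this
    push_cast at this
    linarith
  rw [← Finset.sum_mul] at h
  simp only [Finset.sum_const, Finset.card_univ, Fintype.card_fin, nsmul_eq_mul]
  push_cast
  linarith

/-- Moving by the sum of the `u_j` with `j ∈ S`. -/
lemma NearStd.lin_indicator {k E : ℤ} {u : Fin (n + 1) → Fin (n + 1) → ℤ} (hu : NearStd k E u)
    (S : Finset (Fin (n + 1))) (i : Fin (n + 1)) :
    |lin u (fun j => if j ∈ S then 1 else 0) i -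
      k * (S.card - (n + 1) * (if i ∈ S then 1 else 0))| ≤ E * (n + 1) := by
  have h := hu.lin_close (fun j => if j ∈ S then 1 else 0) i
  have h1 : ∑ j, (if j ∈ S then (1 : ℤ) else 0) = S.card := by simp
  have h2 : ∑ j, |if j ∈ S then (1 : ℤ) else 0| ≤ n + 1 := by
    refine (Finset.sum_le_card_nsmul _ _ 1 fun j _ => ?_).trans (by simp)
    split_ifs <;> simp
  rw [h1] at h
  exact h.trans (mul_le_mul_of_nonneg_left h2 hu.nonneg)

/-- The radius in the description of deep holes. -/
def holeRadius (n : ℕ) (E B : ℤ) : ℤ := (n + 1) * (B + 2 * (E * (n + 1))) + 2 * (E * (n + 1))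

lemma card_filter_perm_lt (p : Equiv.Perm (Fin (n + 1))) (a : ℕ) (ha : a ≤ n + 1) :
    (Finset.univ.filter fun i => (p i : ℕ) < a).card = a := by
  have h : (Finset.univ.filter fun i => (p i : ℕ) < a) =
      (Finset.univ.filter fun i : Fin (n + 1) => (i : ℕ) < a).map p.symm.toEmbedding := by
    ext i
    simp
  rw [h, Finset.card_map, Fin.card_filter_val_lt, min_eq_right ha]

/-- A vector all of whose lattice translates have a coordinate of size almost `n k / 2` is, up to
the lattice, close to a vertex of the permutohedron, up to a bounded error. -/
lemma NearStd.near_hole {k E B : ℤ} {u : Fin (n + 1) → Fin (n + 1) → ℤ} (hu : NearStd k E u)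
    (hk : 8 * (n + 3) * (E + 1) ≤ k) (hk' : B + 2 * (E * (n + 1)) < k) (hB : 0 ≤ B)
    (z : Fin (n + 1) → ℤ) (hz : ∑ i, z i = 0) (i₀ : Fin (n + 1))
    (h : ∀ m, ∃ i, n * k - B ≤ 2 * (z + lin u m) i) :
    ∃ m, ∃ p : Equiv.Perm (Fin (n + 1)), p i₀ = Fin.last n ∧
      Near k (z + lin u m) p (holeRadius n E B) := by
  have hE := hu.nonneg
  obtain ⟨m, hm⟩ := hu.reduce hk z hz
  set y := z + lin u m with hy
  have hysum : ∑ i, y i = 0 := by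
    simp [hy, Finset.sum_add_distrib, hz, hu.sum_lin]
  have hk0 : 0 ≤ k := le_trans (by positivity) hk
  have hnE : 0 ≤ n * E := by positivity
  set B₂ := B + 2 * (E * (n + 1)) with hB₂
  obtain ⟨p, hp⟩ : ∃ p : Equiv.Perm (Fin (n + 1)), ∀ i j, p i ≤ p j → y j ≤ y i := by
    refine ⟨(Tuple.sort fun i => -y i).symm, fun i j hij => ?_⟩
    have := Tuple.monotone_sort (fun i => -y i) hij
    simp only [Function.comp_apply, Equiv.apply_symm_apply] at this
    omega
  have hlow : ∀ i, -B₂ ≤ 2 * y i - k * (n - 2 * ((p i : ℕ) : ℤ)) := by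
    intro i
    -- Let `a = p i` and let `S` consist of the `a` coordinates ranked before `i`. Adding their
    -- `u_j` lowers `S` by about `(n+1-a) k`, too far for a large coordinate to survive there, and
    -- raises the others by about `a k`. The coordinate of size almost `nk/2` is thus outside `S`,
    -- where `y_i` is the largest: `2 y_i ≥ k (n - 2a)` up to a bounded error.
    set S := Finset.univ.filter fun j => (p j : ℕ) < (p i : ℕ) with hS
    have hcard : S.card = (p i : ℕ) := card_filter_perm_lt p _ (p i).is_lt.le
    obtain ⟨j, hj⟩ := h (m + fun j => if j ∈ S then 1 else 0)
    rw [lin_add, ← add_assoc, ← hy, Pi.add_apply] at hj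
    have h1 := (abs_le.mp (hu.lin_indicator S j)).2
    rw [hcard] at h1
    have hpi : ((p i : ℕ) : ℤ) ≤ n := by have := (p i).is_lt; omega
    by_cases hjS : j ∈ S
    · exfalso
      rw [if_pos hjS] at h1
      have h2 := hm j
      have h3 : k * (((p i : ℕ) : ℤ) - (n + 1) * 1) ≤ -k := by nlinarith
      nlinarith
    · rw [if_neg hjS] at h1
      have h2 : y j ≤ y i := hp i j (by simpa [hS] using hjS)
      linarith
  have hdev : ∑ i, (2 * y i - k * (n - 2 * ((p i : ℕ) : ℤ))) = 0 := by
    rw [Finset.sum_sub_distrib, ← Finset.mul_sum, ← Finset.mul_sum, hysum, sum_perm_val]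
    ring
  -- The deviations add up to zero, so `n` lower bounds give an upper bound for the remaining one.
  have hup : ∀ i, 2 * y i - k * (n - 2 * ((p i : ℕ) : ℤ)) ≤ n * B₂ := by
    intro i
    rw [Fin.sum_univ_succAbove _ i] at hdev
    have := Finset.card_nsmul_le_sum Finset.univ
      (fun j => 2 * y (i.succAbove j) - k * (n - 2 * ((p (i.succAbove j) : ℕ) : ℤ))) (-B₂)
      (fun j _ => hlow _)
    simp only [Finset.card_univ, Fintype.card_fin, nsmul_eq_mul] at this
    linarith
  set a : ℕ := (p i₀ : ℕ) with ha
  set S := Finset.univ.filter fun j => (p j : ℕ) < a + 1 with hS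
  have ha' : a ≤ n := Nat.lt_succ_iff.mp (p i₀).is_lt
  have hcard : S.card = a + 1 := card_filter_perm_lt p _ (by omega)
  -- Adding `u_j` for the first `a + 1` ranks rotates the ranks cyclically by `-(a + 1)`, which
  -- sends the rank `a` of `i₀` to `n`.
  refine ⟨m + fun j => if j ∈ S then 1 else 0,
    p.trans (Equiv.addRight (Fin.last n - p i₀)), by simp, ?_⟩
  intro i
  rw [lin_add, ← add_assoc, ← hy, Pi.add_apply]
  have h1 := abs_le.mp (hu.lin_indicator S i)
  have hl := hlow i
  have hu' := hup i
  have hrot : ((((p.trans (Equiv.addRight (Fin.last n - p i₀))) i : Fin (n + 1)) : ℕ) : ℤ) =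
      ((p i : ℕ) : ℤ) - (a + 1) + (n + 1) * (if i ∈ S then 1 else 0) := by
    have e1 : ((Fin.last n - p i₀ : Fin (n + 1)) : ℕ) = n - a := by
      rw [Fin.sub_val_of_le (Fin.le_last _)]
      simp [ha]
    have e2 : ((p.trans (Equiv.addRight (Fin.last n - p i₀))) i : Fin (n + 1)) =
      p i + (Fin.last n - p i₀) := rfl
    have hpi := (p i).is_lt
    rw [e2, Fin.val_add, e1]
    by_cases hi : (p i : ℕ) < a + 1
    · rw [if_pos (by simpa [hS] using hi), Nat.mod_eq_of_lt (by omega)]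
      omega
    · rw [if_neg (by simpa [hS] using hi), Nat.mod_eq_sub_mod (by omega),
        Nat.mod_eq_of_lt (by omega)]
      omega
  rw [hrot]
  rw [hcard] at h1
  have hB₂0 : 0 ≤ B₂ := by positivity
  have hnB : 0 ≤ n * B₂ := by positivity
  unfold holeRadius
  rw [← hB₂]
  push_cast at h1
  rw [abs_le]
  constructor <;> nlinarith

end Combinatorics


/-! ### The absolute value and the supremum norm -/

section Polynomials

variable {F : Type*} [Field F]

/-- It exhibits the leading coefficient of a polynomial at a nonpositive exponent of `x⁻¹`, whence
`|p| ≥ 1` for `p ≠ 0`; all lower bounds for determinants and vectors of lattices rest on this. -/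
lemma polyEmb_coeff (p : Polynomial F) (i : ℕ) : (polyEmb F p).coeff (-(i : ℤ)) = p.coeff i := by
  have hmon : ∀ (j : ℕ) (a : F), polyEmb F (Polynomial.monomial j a) =
      HahnSeries.single (-(j : ℤ)) a := by
    intro j a
    simp [polyEmb, xElt, Polynomial.eval₂_monomial, HahnSeries.single_pow,
      HahnSeries.C_apply, HahnSeries.single_mul_single]
  induction p using Polynomial.induction_on' with
  | add p q hp hq => simp [hp, hq]
  | monomial j a =>
    rw [hmon, Polynomial.coeff_monomial]
    by_cases h : j = i
    · subst h; simp
    · rw [if_neg h, HahnSeries.coeff_single_of_ne]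
      omega

lemma exists_ne_zero_mem_latticeOf {n : ℕ} (g : G F (n + 1)) : ∃ v ∈ latticeOf g, v ≠ 0 := by
  refine ⟨_, ⟨fun _ => 1, rfl⟩, fun h => ?_⟩
  have h1 := congrArg (g⁻¹).val.mulVec h
  rw [Matrix.mulVec_mulVec, ← Units.val_mul, inv_mul_cancel, Units.val_one, Matrix.one_mulVec,
    Matrix.mulVec_zero] at h1
  simpa using congrFun h1 0

end Polynomials

section AbsoluteValue

variable {F : Type*} [Field F] [Fintype F]

lemma one_lt_card_real : (1 : ℝ) < (Fintype.card F : ℝ) := by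
  exact_mod_cast Fintype.one_lt_card

lemma prod_card_zpow {ι : Type*} (s : Finset ι) (f : ι → ℤ) :
    ∏ i ∈ s, (Fintype.card F : ℝ) ^ f i = (Fintype.card F : ℝ) ^ ∑ i ∈ s, f i := by
  classical
  induction s using Finset.induction_on with
  | empty => simp
  | insert i s hi ih =>
    rw [Finset.prod_insert hi, Finset.sum_insert hi, ih, zpow_add₀ card_pos'.ne']

lemma absK_eq_zpow {f : KInf F} (hf : f ≠ 0) : absK f = (Fintype.card F : ℝ) ^ rho f := by
  rw [absK, if_neg hf]

lemma absK_neg (f : KInf F) : absK (-f) = absK f := by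
  by_cases h : f = 0
  · simp [h]
  · rw [absK_eq_zpow h, absK_eq_zpow (neg_ne_zero.mpr h), rho, HahnSeries.order_neg, rho]

lemma absK_add_le (f g : KInf F) : absK (f + g) ≤ max (absK f) (absK g) := by
  by_cases hf : f = 0
  · simp [hf]
  by_cases hg : g = 0
  · simp [hg]
  by_cases hfg : f + g = 0
  · rw [hfg, absK_zero]
    exact le_max_of_le_left (absK_nonneg f)
  have h := HahnSeries.min_order_le_order_add hfg
  rw [absK_eq_zpow hf, absK_eq_zpow hg, absK_eq_zpow hfg]
  have hq := one_lt_card_real (F := F)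
  rcases min_le_iff.mp h with h | h
  · exact le_max_of_le_left (zpow_le_zpow_right₀ hq.le (neg_le_neg h))
  · exact le_max_of_le_right (zpow_le_zpow_right₀ hq.le (neg_le_neg h))

lemma absK_sum_le {ι : Type*} (s : Finset ι) (f : ι → KInf F) {B : ℝ} (hB : 0 ≤ B)
    (h : ∀ i ∈ s, absK (f i) ≤ B) : absK (∑ i ∈ s, f i) ≤ B := by
  classical
  induction s using Finset.induction_on with
  | empty => simpa using hB
  | insert a s ha ih =>
    rw [Finset.sum_insert ha]
    exact (absK_add_le _ _).trans (max_le (h a (Finset.mem_insert_self a s))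
      (ih fun i hi => h i (Finset.mem_insert_of_mem hi)))

lemma absK_sum_lt {ι : Type*} (s : Finset ι) (f : ι → KInf F) {B : ℝ} (hB : 0 < B)
    (h : ∀ i ∈ s, absK (f i) < B) : absK (∑ i ∈ s, f i) < B := by
  classical
  induction s using Finset.induction_on with
  | empty => simpa using hB
  | insert a s ha ih =>
    rw [Finset.sum_insert ha]
    exact (absK_add_le _ _).trans_lt (max_lt (h a (Finset.mem_insert_self a s))
      (ih fun i hi => h i (Finset.mem_insert_of_mem hi)))

lemma absK_xElt : absK (xElt F) = Fintype.card F := by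
  rw [absK_eq_zpow xElt_ne_zero, rho, xElt, HahnSeries.order_single one_ne_zero, neg_neg, zpow_one]

lemma absK_perm_sign {m : ℕ} (σ : Equiv.Perm (Fin m)) (f : KInf F) :
    absK (((Equiv.Perm.sign σ : ℤ) : KInf F) * f) = absK f := by
  rcases Int.units_eq_one_or (Equiv.Perm.sign σ) with h | h
  · simp [h]
  · simp [h, absK_neg]

/-- The ultrametric Hadamard inequality. -/
lemma absK_det_le {m : ℕ} (A : Matrix (Fin m) (Fin m) (KInf F)) (B : Fin m → ℝ)
    (hA : ∀ i j, absK (A i j) ≤ B j) : absK A.det ≤ ∏ j, B j := by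
  have hB : ∀ j, 0 ≤ B j := fun j => (absK_nonneg _).trans (hA j j)
  rw [Matrix.det_apply']
  refine absK_sum_le _ _ (Finset.prod_nonneg fun j _ => hB j) fun σ _ => ?_
  rw [absK_perm_sign, absK_prod]
  exact Finset.prod_le_prod (fun j _ => absK_nonneg _) fun j _ => hA _ _

lemma one_le_absK_polyEmb {p : Polynomial F} (hp : p ≠ 0) : 1 ≤ absK (polyEmb F p) := by
  have h := Polynomial.leadingCoeff_ne_zero.mpr hp
  rw [Polynomial.leadingCoeff, ← polyEmb_coeff] at h
  have h0 : polyEmb F p ≠ 0 := fun h0 => h (by rw [h0]; rfl)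
  rw [absK_eq_zpow h0]
  refine one_le_zpow₀ one_lt_card_real.le ?_
  have := HahnSeries.order_le_of_coeff_ne_zero h
  unfold rho
  omega

lemma absK_le_supNorm {d : ℕ} (v : Fin d → KInf F) (i : Fin d) : absK (v i) ≤ supNorm v :=
  le_ciSup (f := fun i => absK (v i)) (Set.finite_range _).bddAbove i

lemma exists_absK_eq_supNorm {n : ℕ} (v : Fin (n + 1) → KInf F) : ∃ i, absK (v i) = supNorm v :=
  exists_eq_ciSup_of_finite

lemma supNorm_nonneg {d : ℕ} (v : Fin d → KInf F) : 0 ≤ supNorm v :=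
  Real.iSup_nonneg fun i => absK_nonneg (v i)

lemma supNorm_pos {d : ℕ} {v : Fin d → KInf F} (hv : v ≠ 0) : 0 < supNorm v := by
  obtain ⟨i, hi⟩ := Function.ne_iff.mp hv
  exact (absK_pos hi).trans_le (absK_le_supNorm v i)

lemma exists_supNorm_eq_zpow {n : ℕ} {v : Fin (n + 1) → KInf F} (hv : v ≠ 0) :
    ∃ e : ℤ, supNorm v = (Fintype.card F : ℝ) ^ e := by
  obtain ⟨i, hi⟩ := exists_absK_eq_supNorm v
  have h : v i ≠ 0 := fun h => (supNorm_pos hv).ne' (by rw [← hi, h, absK_zero])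
  exact ⟨rho (v i), by rw [← hi, absK_eq_zpow h]⟩

end AbsoluteValue

/-! ### The diagonal group -/

section DiagonalGroup

variable {F : Type*} [Field F] [Fintype F] {d : ℕ}

lemma val_eq_diagonal (a : A1 F d) : a.val.val = Matrix.diagonal (entry a) :=
  a.2.1.diagonal_diag.symm

lemma A1.ext_entry {a b : A1 F d} (h : ∀ i, entry a i = entry b i) : a = b := by
  refine Subtype.ext (Units.ext ?_)
  rw [val_eq_diagonal, val_eq_diagonal, funext h]

lemma A1.mul_comm' (a b : A1 F d) : a * b = b * a :=
  A1.ext_entry fun i => by rw [entry_mul, entry_mul, mul_comm]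

lemma prod_absK_entry (a : A1 F d) : ∏ i, absK (entry a i) = 1 := by
  rw [← absK_prod, ← Matrix.det_diagonal, ← val_eq_diagonal]
  exact a.2.2

lemma entry_ne_zero (a : A1 F d) (i : Fin d) : entry a i ≠ 0 := fun h => by
  have := prod_absK_entry a
  rw [Finset.prod_eq_zero (Finset.mem_univ i) (by rw [h, absK_zero])] at this
  exact zero_ne_one this

lemma entry_diagA1 (v : Fin d → KInf F) (hv : ∏ i, absK (v i) = 1) (i : Fin d) :
    entry (diagA1 v hv) i = v i := by
  change Matrix.diagonal v i i = v i
  simp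

/-- The vector `ρ(a)`, with integer coordinates. -/
noncomputable def rhoZ (a : A1 F d) (i : Fin d) : ℤ := rho (entry a i)

lemma rhoVec_eq (a : A1 F d) (i : Fin d) : rhoVec a i = (rhoZ a i : ℝ) := rfl

lemma absK_entry (a : A1 F d) (i : Fin d) :
    absK (entry a i) = (Fintype.card F : ℝ) ^ rhoZ a i := absK_eq_zpow (entry_ne_zero a i)

lemma rhoZ_mul (a b : A1 F d) : rhoZ (a * b) = rhoZ a + rhoZ b := by
  ext i
  simp only [rhoZ, rho, entry_mul, Pi.add_apply,
    HahnSeries.order_mul (entry_ne_zero a i) (entry_ne_zero b i)]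
  ring

lemma rhoZ_one : rhoZ (1 : A1 F d) = 0 := by
  ext i
  simp [rhoZ, rho, entry_one]

lemma rhoZ_inv (a : A1 F d) : rhoZ a⁻¹ = -rhoZ a := by
  have h := rhoZ_mul a a⁻¹
  rw [mul_inv_cancel, rhoZ_one] at h
  exact (neg_eq_of_add_eq_zero_right h.symm).symm

lemma sum_rhoZ (a : A1 F d) : ∑ i, rhoZ a i = 0 := by
  have h := prod_absK_entry a
  simp only [absK_entry] at h
  rw [prod_card_zpow] at h
  exact (zpow_eq_one_iff_right₀ card_pos'.le one_lt_card_real.ne').mp h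

/-- The homomorphism `ρ`, with multiplicative target. -/
noncomputable def rhoHom (F : Type*) [Field F] [Fintype F] (d : ℕ) :
    A1 F d →* Multiplicative (Fin d → ℤ) where
  toFun a := Multiplicative.ofAdd (rhoZ a)
  map_one' := by rw [rhoZ_one]; rfl
  map_mul' a b := by rw [rhoZ_mul]; rfl

lemma rhoZ_pow (a : A1 F d) (k : ℕ) : rhoZ (a ^ k) = k • rhoZ a :=
  map_pow (rhoHom F d) a k

lemma mem_A1U_iff {a : A1 F d} : a ∈ A1U F d ↔ rhoZ a = 0 := by
  change (∀ i, absK (entry a i) = 1) ↔ _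
  simp only [absK_entry, funext_iff]
  refine forall_congr' fun i => ?_
  exact zpow_eq_one_iff_right₀ (zero_le_one.trans one_lt_card_real.le) one_lt_card_real.ne'

lemma rhoZ_stdVec {n : ℕ} (l i : Fin (n + 1)) :
    rhoZ (stdVec F l) i = 1 - if i = l then (n : ℤ) + 1 else 0 := by
  have h := absK_entry (stdVec F l) i
  have he : entry (stdVec F l) i = if i = l then xElt F ^ (-(n : ℤ)) else xElt F :=
    entry_diagA1 _ _ i
  have hinj := zpow_right_injective₀ (card_pos' (F := F)) one_lt_card_real.ne'
  rw [he] at h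
  split_ifs at h ⊢ with hi
  · rw [absK_zpow, absK_xElt] at h
    have := hinj h
    omega
  · rw [absK_xElt] at h
    have := hinj ((zpow_one _).trans h)
    omega

end DiagonalGroup

/-! ### Lattices and their stabilizers -/

section LatticeLemmas

variable {F : Type*} [Field F] [Fintype F] {n : ℕ}

lemma absK_det_pos (g : G F n) : 0 < absK g.val.det :=
  absK_pos ((Matrix.isUnit_iff_isUnit_det _).mp g.isUnit).ne_zero

/-- Lattices are discrete. -/
lemma exists_le_supNorm (g : G F (n + 1)) :
    ∃ e : ℤ, ∀ v ∈ latticeOf g, v ≠ 0 → (Fintype.card F : ℝ) ^ e ≤ supNorm v := by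
  obtain ⟨N, hN⟩ : ∃ N : ℕ, ∀ i j, absK ((g⁻¹).val i j) ≤ (Fintype.card F : ℝ) ^ N := by
    have hB : BddAbove (Set.range fun ij : Fin (n + 1) × Fin (n + 1) =>
      absK ((g⁻¹).val ij.1 ij.2)) := (Set.finite_range _).bddAbove
    obtain ⟨B, hB⟩ := hB
    obtain ⟨N, hN⟩ := pow_unbounded_of_one_lt B (one_lt_card_real (F := F))
    exact ⟨N, fun i j => (hB ⟨(i, j), rfl⟩).trans hN.le⟩
  refine ⟨-N, ?_⟩
  rintro _ ⟨p, rfl⟩ hv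
  set v := g.val.mulVec fun i => polyEmb F (p i) with hvdef
  have hp : (g⁻¹).val.mulVec v = fun i => polyEmb F (p i) := by
    rw [hvdef, Matrix.mulVec_mulVec, ← Units.val_mul, inv_mul_cancel, Units.val_one,
      Matrix.one_mulVec]
  obtain ⟨i, hi⟩ : ∃ i, p i ≠ 0 := by
    by_contra! h
    exact hv (by simp [h, funext_iff, Matrix.mulVec, dotProduct])
  have h1 : 1 ≤ (Fintype.card F : ℝ) ^ N * supNorm v := by
    refine (one_le_absK_polyEmb hi).trans ?_
    rw [← congrFun hp i]
    have hB := mul_nonneg (pow_nonneg (card_pos' (F := F)).le N) (supNorm_nonneg v)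
    refine absK_sum_le Finset.univ (fun j => (g⁻¹).val i j * v j) hB fun j _ => ?_
    rw [absK_mul]
    exact mul_le_mul (hN i j) (absK_le_supNorm v j) (absK_nonneg _) (pow_nonneg card_pos'.le _)
  rw [zpow_neg, zpow_natCast]
  exact (inv_le_iff_one_le_mul₀' (pow_pos card_pos' N)).mpr h1

lemma exists_shortest (g : G F (n + 1)) :
    ∃ v ∈ latticeOf g, v ≠ 0 ∧ ∀ w ∈ latticeOf g, w ≠ 0 → supNorm v ≤ supNorm w := by
  obtain ⟨e, he⟩ := exists_le_supNorm g
  have hq := one_lt_card_real (F := F)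
  let P : ℤ → Prop := fun e' => ∃ v ∈ latticeOf g, v ≠ 0 ∧ supNorm v = (Fintype.card F : ℝ) ^ e'
  have hne : ∃ e', P e' := by
    obtain ⟨v, hv, hv0⟩ := exists_ne_zero_mem_latticeOf g
    obtain ⟨e', he'⟩ := exists_supNorm_eq_zpow hv0
    exact ⟨e', v, hv, hv0, he'⟩
  obtain ⟨e₁, ⟨v, hv, hv0, hve⟩, hmin⟩ := Int.exists_least_of_bdd (P := P) ⟨e, fun e' he' => by
    obtain ⟨v, hv, hv0, hve⟩ := he'
    have := he v hv hv0
    rw [hve] at this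
    exact (zpow_le_zpow_iff_right₀ hq).mp this⟩ hne
  refine ⟨v, hv, hv0, fun w hw hw0 => ?_⟩
  obtain ⟨e', he'⟩ := exists_supNorm_eq_zpow hw0
  rw [hve, he']
  exact zpow_le_zpow_right₀ hq.le (hmin e' ⟨w, hw, hw0, he'⟩)

lemma ellG_eq {g : G F (n + 1)} {v : Fin (n + 1) → KInf F} (hv : v ∈ latticeOf g) (hv0 : v ≠ 0)
    (hmin : ∀ w ∈ latticeOf g, w ≠ 0 → supNorm v ≤ supNorm w) :
    supNorm v = ellG g * absK g.val.det ^ (1 / ((n : ℝ) + 1)) := by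
  have h : sInf {s : ℝ | ∃ v ∈ latticeOf g, v ≠ 0 ∧ supNorm v = s} = supNorm v :=
    IsLeast.csInf_eq ⟨⟨v, hv, hv0, rfl⟩, by rintro _ ⟨w, hw, hw0, rfl⟩; exact hmin w hw hw0⟩
  rw [ellG, h, Real.rpow_neg (absK_nonneg _)]
  have := (Real.rpow_pos_of_pos (absK_det_pos g) (1 / ((n : ℝ) + 1))).ne'
  push_cast
  field_simp

/-- The infimum is attained, so it can be replaced by an inequality for each nonzero vector. The
determinant factor is constant along `A₁`-orbits. -/
lemma le_ellG_iff {g : G F (n + 1)} {δ : ℝ} : δ ≤ ellG g ↔ ∀ w ∈ latticeOf g, w ≠ 0 →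
    δ * absK g.val.det ^ (1 / ((n : ℝ) + 1)) ≤ supNorm w := by
  obtain ⟨v, hv, hv0, hmin⟩ := exists_shortest g
  have h := ellG_eq hv hv0 hmin
  have hpos := Real.rpow_pos_of_pos (absK_det_pos g) (1 / ((n : ℝ) + 1))
  constructor
  · intro hδ w hw hw0
    exact (mul_le_mul_of_nonneg_right hδ hpos.le).trans (h ▸ hmin w hw hw0)
  · intro hw
    have := hw v hv hv0
    rw [h] at this
    exact le_of_mul_le_mul_right this hpos

lemma det_diag_mul (a : A1 F n) (g : G F n) :
    absK ((a : G F n) * g).val.det = absK g.val.det := by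
  rw [Units.val_mul, Matrix.det_mul, absK_mul, a.2.2, one_mul]

lemma mem_latticeOf_diag_mul {a : A1 F n} {g : G F n} {w : Fin n → KInf F} :
    w ∈ latticeOf ((a : G F n) * g) ↔ ∃ v ∈ latticeOf g, w = fun i => entry a i * v i := by
  have key : ∀ v : Fin n → KInf F, (a : G F n).val.mulVec v = fun i => entry a i * v i := by
    intro v
    ext i
    rw [val_eq_diagonal, Matrix.mulVec_diagonal]
  constructor
  · rintro ⟨p, rfl⟩
    refine ⟨_, ⟨p, rfl⟩, ?_⟩
    rw [← key, Matrix.mulVec_mulVec, Units.val_mul]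
  · rintro ⟨_, ⟨p, rfl⟩, rfl⟩
    refine ⟨p, ?_⟩
    rw [← key, Matrix.mulVec_mulVec, Units.val_mul]

/-- Linearly independent vectors of a lattice span at least its covolume. -/
lemma det_le_of_mem_latticeOf (g : G F n) (A : Matrix (Fin n) (Fin n) (KInf F))
    (hA : A.det ≠ 0) (hmem : ∀ j, (fun i => A i j) ∈ latticeOf g) :
    absK g.val.det ≤ absK A.det := by
  choose p hp using hmem
  let P : Matrix (Fin n) (Fin n) (Polynomial F) := fun i j => p j i
  have h : A = g.val * P.map (polyEmb F) := by
    refine Matrix.ext fun i j => ?_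
    exact (congrFun (hp j) i).symm
  have hdet : A.det = g.val.det * polyEmb F P.det := by
    rw [h, Matrix.det_mul, RingHom.map_det]
    rfl
  have hP : P.det ≠ 0 := fun h0 => hA (by rw [hdet, h0, map_zero, mul_zero])
  rw [hdet, absK_mul]
  exact le_mul_of_one_le_right (absK_nonneg _) (one_le_absK_polyEmb hP)

lemma smul_mk (a : A1 F n) (g : G F n) :
    a • (QuotientGroup.mk g : LatSpace F n) = QuotientGroup.mk ((a : G F n) * g) := rfl

/-- An element of the stabilizer preserves the lattice up to a scalar of absolute value one. -/
lemma exists_scalar_of_mem_stab {g : G F (n + 1)} {s : A1 F (n + 1)}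
    (hs : s ∈ stab (QuotientGroup.mk g : LatSpace F (n + 1))) :
    ∃ z : KInf F, absK z = 1 ∧ ∀ v ∈ latticeOf g, (fun i => z * entry s i * v i) ∈ latticeOf g := by
  have h1 : (QuotientGroup.mk g : LatSpace F (n + 1)) = QuotientGroup.mk ((s : G F (n + 1)) * g) :=
    (smul_mk s g).symm.trans (MulAction.mem_stabilizer_iff.mp hs) |>.symm
  rw [QuotientGroup.eq] at h1
  obtain ⟨z, hz, γ, hγ, h⟩ := Subgroup.mem_sup_of_normal_left.mp h1
  rw [Matrix.GeneralLinearGroup.center_eq_range_scalar] at hz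
  obtain ⟨c, rfl⟩ := hz
  have hsg : (s : G F (n + 1)) * g = g * Matrix.GeneralLinearGroup.scalar (Fin (n + 1)) c * γ := by
    rw [mul_assoc, h, mul_inv_cancel_left]
  have hval : (g * Matrix.GeneralLinearGroup.scalar (Fin (n + 1)) c).val = (c : KInf F) • g.val := by
    ext i j
    simp [Matrix.GeneralLinearGroup.scalar, mul_comm]
  have hlat : latticeOf ((s : G F (n + 1)) * g) =
      latticeOf (g * Matrix.GeneralLinearGroup.scalar (Fin (n + 1)) c) := by
    rw [hsg, latticeOf_mul_gamma _ hγ]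
  have hc : (c : KInf F) ≠ 0 := c.ne_zero
  have habs : absK (c : KInf F) = 1 := by
    -- Neither `s` nor `γ` changes the absolute value of the determinant, so the scalar satisfies
    -- `|c|^(n+1) = 1`.
    have hd := det_diag_mul s g
    have hγ1 : absK γ.val.det = 1 := by
      obtain ⟨γ, rfl⟩ := hγ
      have h : (Matrix.GeneralLinearGroup.map (polyEmb F) γ).val.det = polyEmb F γ.val.det := by
        rw [RingHom.map_det]
        rfl
      rw [h, absK_polyEmb_unit ((Matrix.isUnit_iff_isUnit_det _).mp γ.isUnit)]
    rw [hsg, Units.val_mul, hval, Matrix.det_mul, Matrix.det_smul, absK_mul, absK_mul, absK_pow,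
      hγ1, mul_one, Fintype.card_fin] at hd
    have h1 := (mul_eq_right₀ (absK_det_pos g).ne').mp hd
    exact (pow_eq_one_iff_of_nonneg (absK_nonneg _) n.succ_ne_zero).mp h1
  refine ⟨(c : KInf F)⁻¹, by
    have := absK_mul (c : KInf F) (c : KInf F)⁻¹
    rw [mul_inv_cancel₀ hc, absK_one, habs, one_mul] at this
    exact this.symm, fun v hv => ?_⟩
  have hmem : (fun i => entry s i * v i) ∈ latticeOf ((s : G F (n + 1)) * g) :=
    mem_latticeOf_diag_mul.mpr ⟨v, hv, rfl⟩
  rw [hlat] at hmem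
  obtain ⟨p, hp⟩ := hmem
  refine ⟨p, ?_⟩
  dsimp only at hp ⊢
  rw [hval, Matrix.smul_mulVec] at hp
  ext i
  have := congrFun hp i
  rw [Pi.smul_apply, smul_eq_mul] at this
  rw [mul_assoc, ← this, inv_mul_cancel_left₀ hc]

end LatticeLemmas


/-! ### Rigidity of the stabilizer of a tight lattice -/

section Rigidity

variable {F : Type*} [Field F] [Fintype F] {n : ℕ}

lemma exists_lin_of_mem_genGroup {b : Fin (n + 1) → A1 F (n + 1)} {γ : A1 F (n + 1)}
    (hγ : γ ∈ genGroup b) : ∃ m, rhoZ γ = lin (fun l => rhoZ (b l)) m := by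
  refine Subgroup.closure_induction (p := fun γ _ => ∃ m, rhoZ γ = lin (fun l => rhoZ (b l)) m)
    ?_ ?_ ?_ ?_ hγ
  · rintro _ ⟨l, rfl⟩
    exact ⟨Pi.single l 1, (lin_single (fun l => rhoZ (b l)) l).symm⟩
  · exact ⟨0, by rw [rhoZ_one]; ext i; simp [lin]⟩
  · rintro x y _ _ ⟨m, hm⟩ ⟨m', hm'⟩
    exact ⟨m + m', by rw [rhoZ_mul, lin_add, hm, hm']⟩
  · rintro x _ ⟨m, hm⟩
    exact ⟨-m, by rw [rhoZ_inv, hm]; ext i; simp [lin]⟩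

lemma exists_mem_genGroup_lin (b : Fin (n + 1) → A1 F (n + 1)) (m : Fin (n + 1) → ℤ) :
    ∃ γ ∈ genGroup b, rhoZ γ = lin (fun l => rhoZ (b l)) m := by
  let L : AddSubgroup (Fin (n + 1) → ℤ) :=
    { carrier := {v | ∃ γ ∈ genGroup b, rhoZ γ = v}
      zero_mem' := ⟨1, one_mem _, rhoZ_one⟩
      add_mem' := by
        rintro _ _ ⟨γ, hγ, rfl⟩ ⟨γ', hγ', rfl⟩
        exact ⟨γ * γ', mul_mem hγ hγ', rhoZ_mul _ _⟩
      neg_mem' := by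
        rintro _ ⟨γ, hγ, rfl⟩
        exact ⟨γ⁻¹, inv_mem hγ, rhoZ_inv _⟩ }
  have h : lin (fun l => rhoZ (b l)) m = ∑ j, m j • rhoZ (b j) := by
    ext i
    simp [lin]
  have hmem : lin (fun l => rhoZ (b l)) m ∈ L := by
    rw [h]
    refine sum_mem fun j _ => zsmul_mem ?_ _
    exact ⟨b j, Subgroup.subset_closure ⟨j, rfl⟩, rfl⟩
  exact hmem

/-- The class of `g` is stabilized by the almost standard elements `b_l`, and the shortest vector
`v` of the lattice of `g` is as short as tightness demands. -/
structure TightData (k E B₀ : ℤ) (g : G F (n + 1)) (b : Fin (n + 1) → A1 F (n + 1))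
    (v : Fin (n + 1) → KInf F) : Prop where
  near : NearStd k E fun l => rhoZ (b l)
  le_stab : genGroup b ≤ stab (QuotientGroup.mk g : LatSpace F (n + 1))
  mem : v ∈ latticeOf g
  ne_zero : v ≠ 0
  shortest : ∀ w ∈ latticeOf g, w ≠ 0 → supNorm v ≤ supNorm w
  tight : ellG g ^ 2 * (Fintype.card F : ℝ) ^ (n * k - B₀) ≤ 1

variable {k E B₀ : ℤ} {g : G F (n + 1)} {b : Fin (n + 1) → A1 F (n + 1)} {v : Fin (n + 1) → KInf F}

lemma TightData.supNorm_eq (h : TightData k E B₀ g b v) :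
    supNorm v = ellG g * absK g.val.det ^ (1 / ((n : ℝ) + 1)) :=
  ellG_eq h.mem h.ne_zero h.shortest

lemma TightData.ellG_nonneg (h : TightData k E B₀ g b v) : 0 ≤ ellG g := by
  have h1 := supNorm_nonneg v
  rw [h.supNorm_eq] at h1
  exact nonneg_of_mul_nonneg_left h1 (Real.rpow_pos_of_pos (absK_det_pos g) _)

lemma TightData.supNorm_pow (h : TightData k E B₀ g b v) :
    supNorm v ^ (n + 1) = ellG g ^ (n + 1) * absK g.val.det := by
  rw [h.supNorm_eq, mul_pow, ← Real.rpow_natCast (_ ^ _), ← Real.rpow_mul (absK_nonneg _)]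
  have : 1 / ((n : ℝ) + 1) * ((n + 1 : ℕ) : ℝ) = 1 := by
    push_cast
    field_simp
  rw [this, Real.rpow_one]

/-- No coordinate of the shortest vector vanishes. -/
lemma TightData.coord_ne_zero (h : TightData k E B₀ g b v) (hk : E < k) (i : Fin (n + 1)) :
    v i ≠ 0 := by
  intro hi
  -- If `v_i = 0`, then `b_i⁻¹`, which expands only the coordinate `i`, carries `v` to a strictly
  -- shorter nonzero vector of the lattice.
  obtain ⟨z, hz, hmem⟩ := exists_scalar_of_mem_stab
    (inv_mem (h.le_stab (Subgroup.subset_closure ⟨i, rfl⟩)))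
  have hz0 : z ≠ 0 := fun h0 => by rw [h0, absK_zero] at hz; exact zero_ne_one hz
  have hne : (fun j => z * entry (b i)⁻¹ j * v j) ≠ 0 := by
    obtain ⟨j, hj⟩ := Function.ne_iff.mp h.ne_zero
    exact Function.ne_iff.mpr ⟨j, mul_ne_zero (mul_ne_zero hz0 (entry_ne_zero _ _)) hj⟩
  have hle := h.shortest _ (hmem v h.mem) hne
  obtain ⟨j, hj⟩ := exists_absK_eq_supNorm (fun j => z * entry (b i)⁻¹ j * v j)
  rw [← hj, absK_mul, absK_mul, hz, one_mul, absK_entry] at hle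
  have hpos := supNorm_pos h.ne_zero
  by_cases hji : j = i
  · rw [hji, hi, absK_zero, mul_zero] at hle
    linarith
  · have hc := (abs_le.mp (h.near.close i j)).1
    rw [if_neg hji] at hc
    have hneg : rhoZ (b i)⁻¹ j < 0 := by
      rw [rhoZ_inv, Pi.neg_apply]
      omega
    have h1 : (Fintype.card F : ℝ) ^ rhoZ (b i)⁻¹ j < 1 := zpow_lt_one_of_neg₀ one_lt_card_real hneg
    have h2 := absK_le_supNorm v j
    have h3 : 0 < absK (v j) := by
      refine lt_of_le_of_ne (absK_nonneg _) fun h3 => ?_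
      rw [← h3, mul_zero] at hle
      linarith
    have h4 := mul_lt_mul_of_pos_right h1 h3
    linarith

/-- Independent elements of the stabilizer cannot all be small. -/
lemma TightData.le_sum_of_det_ne_zero (h : TightData k E B₀ g b v) (hk : E < k)
    {γ : Fin (n + 1) → A1 F (n + 1)}
    (hγ : ∀ j, γ j ∈ stab (QuotientGroup.mk g : LatSpace F (n + 1)))
    (hdet : (Matrix.of fun i j => entry (γ j) i).det ≠ 0) {B : Fin (n + 1) → ℤ}
    (hB : ∀ i j, rhoZ (γ j) i ≤ B j) : (n + 1) * (n * k - B₀) ≤ 2 * ∑ j, B j := by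
  have hq := one_lt_card_real (F := F)
  choose z hz hmem using fun j => exists_scalar_of_mem_stab (hγ j)
  have hz0 : ∀ j, z j ≠ 0 := fun j h0 => by
    have := hz j
    rw [h0, absK_zero] at this
    exact zero_ne_one this
  set A : Matrix (Fin (n + 1)) (Fin (n + 1)) (KInf F) := Matrix.of fun i j => entry (γ j) i with hA
  let A' : Matrix (Fin (n + 1)) (Fin (n + 1)) (KInf F) :=
    Matrix.of fun i j => z j * entry (γ j) i * v i
  have hA' : A' = Matrix.diagonal v * A * Matrix.diagonal z := by
    refine Matrix.ext fun i j => ?_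
    rw [Matrix.mul_diagonal, Matrix.diagonal_mul]
    simp only [A', hA, Matrix.of_apply]
    ring
  have hdet' : A'.det = (∏ i, v i) * A.det * ∏ j, z j := by
    rw [hA', Matrix.det_mul, Matrix.det_mul, Matrix.det_diagonal, Matrix.det_diagonal]
  have hne : A'.det ≠ 0 := by
    rw [hdet']
    exact mul_ne_zero (mul_ne_zero (Finset.prod_ne_zero_iff.mpr fun i _ => h.coord_ne_zero hk i)
      hdet) (Finset.prod_ne_zero_iff.mpr fun j _ => hz0 j)
  -- The columns of `A'` are the lattice vectors `z_j γ_j v`, and `|det A'| = ∏ |v_i| · |det A| ≤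
  -- ‖v‖^(n+1) q^(∑ B_j)`. Since `‖v‖^(n+1) = ℓ^(n+1) |det g|`, comparison with `|det g|` leaves `1
  -- ≤ ℓ^(n+1) q^(∑ B_j)`; squaring brings in the tightness bound for `ℓ²`.
  have h1 := det_le_of_mem_latticeOf g A' hne fun j => hmem j v h.mem
  rw [hdet', absK_mul, absK_mul, absK_prod, absK_prod, Finset.prod_eq_one fun j _ => hz j,
    mul_one] at h1
  have h2 : absK A.det ≤ (Fintype.card F : ℝ) ^ ∑ j, B j := by
    rw [← prod_card_zpow]
    refine absK_det_le A _ fun i j => ?_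
    rw [hA, Matrix.of_apply, absK_entry]
    exact zpow_le_zpow_right₀ hq.le (hB i j)
  have h3 : ∏ i, absK (v i) ≤ supNorm v ^ (n + 1) := by
    refine (Finset.prod_le_prod (fun i _ => absK_nonneg _) fun i _ => absK_le_supNorm v i).trans ?_
    simp
  rw [h.supNorm_pow] at h3
  have hD := absK_det_pos g
  have hell := h.ellG_nonneg
  have h4 : 1 ≤ ellG g ^ (n + 1) * (Fintype.card F : ℝ) ^ ∑ j, B j := by
    have h5 := h1.trans (mul_le_mul h3 h2 (absK_nonneg _) (by positivity))
    refine le_of_mul_le_mul_left (a := absK g.val.det) ?_ hD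
    linarith
  have h5 : (ellG g ^ 2) ^ (n + 1) * ((Fintype.card F : ℝ) ^ (n * k - B₀)) ^ (n + 1) ≤ 1 := by
    rw [← mul_pow]
    have := card_pos' (F := F)
    exact pow_le_one₀ (by positivity) h.tight
  have h6 : 1 ≤ (ellG g ^ 2) ^ (n + 1) * ((Fintype.card F : ℝ) ^ ∑ j, B j) ^ 2 := by
    rw [← pow_mul, mul_comm 2, pow_mul, ← mul_pow]
    exact one_le_pow₀ h4
  have hpos : 0 < (ellG g ^ 2) ^ (n + 1) := by
    by_contra hcon
    have h7 : (ellG g ^ 2) ^ (n + 1) = 0 := le_antisymm (not_lt.mp hcon) (by positivity)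
    rw [h7, zero_mul] at h6
    linarith
  have h7 := le_of_mul_le_mul_left (h5.trans h6) hpos
  rw [← zpow_natCast, ← zpow_natCast, ← zpow_mul, ← zpow_mul] at h7
  have h8 := (zpow_le_zpow_iff_right₀ hq).mp h7
  push_cast at h8
  linarith

lemma exists_apply_lt_of_ne_one {σ : Equiv.Perm (Fin (n + 1))} (hσ : σ ≠ 1) : ∃ j, σ j < j := by
  by_contra! hcon
  refine hσ (Equiv.ext fun j => ?_)
  have hsum : ∑ j, ((j : Fin (n + 1)) : ℕ) = ∑ j, (σ j : ℕ) :=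
    (Equiv.sum_comp σ fun j => (j : ℕ)).symm
  have := (Finset.sum_eq_sum_iff_of_le fun j _ => Fin.le_def.mp (hcon j)).mp hsum j
    (Finset.mem_univ j)
  exact Fin.ext this.symm

/-- The chain `1, b_0, b_0 b_1, …` of stabilizing elements, up to elements of `A₁(U)`, is linearly
independent. -/
lemma exists_chain (hu : NearStd k E fun l => rhoZ (b l)) (hk : 2 * (E * (n + 1)) < k) :
    ∃ P : Fin (n + 1) → A1 F (n + 1), P 0 = 1 ∧ (∀ j, P j ∈ genGroup b) ∧
      (∀ j i, rhoZ (P j) i ≤ k * (j : ℕ) + E * (n + 1)) ∧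
      (Matrix.of fun i j => entry (P j) i).det ≠ 0 := by
  have hE := hu.nonneg
  have hex : ∀ j : Fin (n + 1), ∃ γ : A1 F (n + 1), (j = 0 → γ = 1) ∧ γ ∈ genGroup b ∧
      ∀ i, |rhoZ γ i - k * ((j : ℕ) - (n + 1) * if i < j then 1 else 0)| ≤ E * (n + 1) := by
    intro j
    by_cases hj : j = 0
    · refine ⟨1, fun _ => rfl, one_mem _, fun i => ?_⟩
      subst hj
      rw [rhoZ_one]
      simp
      positivity
    -- For `j > 0` take a product of the `b_i` with `i < j`, with `ρ ≈ k j` at the coordinates `i ≥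
    -- j` and `≈ k (j - n - 1)` at `i < j`.
    · obtain ⟨γ, hγ, hγ'⟩ := exists_mem_genGroup_lin b
        (fun i => if i ∈ Finset.univ.filter (fun i : Fin (n + 1) => (i : ℕ) < (j : ℕ)) then 1 else 0)
      refine ⟨γ, fun h => absurd h hj, hγ, fun i => ?_⟩
      have h := hu.lin_indicator (Finset.univ.filter fun i : Fin (n + 1) => (i : ℕ) < (j : ℕ)) i
      rw [← hγ', show (Finset.univ.filter fun i : Fin (n + 1) => (i : ℕ) < (j : ℕ)).card = j from
        card_filter_perm_lt 1 j j.is_lt.le] at h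
      simpa using h
  choose P hP0 hPmem hP using hex
  have hk0 : 0 < k := lt_of_le_of_lt (by positivity) hk
  refine ⟨P, hP0 0 rfl, hPmem, fun j i => ?_, ?_⟩
  · have h := (abs_le.mp (hP j i)).2
    split_ifs at h <;> nlinarith
  have hq := one_lt_card_real (F := F)
  set A : Matrix (Fin (n + 1)) (Fin (n + 1)) (KInf F) := Matrix.of fun i j => entry (P j) i with hA
  intro hdet
  rw [Matrix.det_apply', ← Finset.add_sum_erase _ _ (Finset.mem_univ 1)] at hdet
  have hterm : ∀ σ : Equiv.Perm (Fin (n + 1)), absK (∏ i, A (σ i) i) =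
      (Fintype.card F : ℝ) ^ ∑ j, rhoZ (P j) (σ j) := by
    intro σ
    rw [absK_prod, ← prod_card_zpow]
    exact Finset.prod_congr rfl fun j _ => by rw [hA, Matrix.of_apply, absK_entry]
  have hlow : ∑ j : Fin (n + 1), (k * ((j : ℕ) : ℤ) - E * (n + 1)) ≤ ∑ j, rhoZ (P j) j := by
    refine Finset.sum_le_sum fun j _ => ?_
    have h := (abs_le.mp (hP j j)).1
    rw [if_neg (lt_irrefl j)] at h
    linarith
  -- The identity gives the strictly dominant term of the Leibniz expansion: any other permutation
  -- has some `σ j₀ < j₀`, an entry that loses `(n+1) k`. By the ultrametric inequality the dominant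
  -- term cannot cancel.
  have hup : ∀ σ : Equiv.Perm (Fin (n + 1)), σ ≠ 1 → ∑ j, rhoZ (P j) (σ j) < ∑ j, rhoZ (P j) j := by
    intro σ hσ
    obtain ⟨j₀, hj₀⟩ := exists_apply_lt_of_ne_one hσ
    refine lt_of_lt_of_le ?_ hlow
    have h1 : ∀ j, rhoZ (P j) (σ j) ≤ k * ((j : ℕ) : ℤ) + E * (n + 1) -
        if j = j₀ then (n + 1) * k else 0 := by
      intro j
      have h := (abs_le.mp (hP j (σ j))).2
      by_cases hj : j = j₀
      · subst hj
        rw [if_pos hj₀] at h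
        rw [if_pos rfl]
        linarith
      · rw [if_neg hj]
        have hn : 0 ≤ (n : ℤ) * k := by positivity
        split_ifs at h <;> nlinarith
    refine (Finset.sum_le_sum fun j _ => h1 j).trans_lt ?_
    simp only [Finset.sum_sub_distrib, Finset.sum_add_distrib, Finset.sum_const, Finset.card_univ,
      Fintype.card_fin, Finset.sum_ite_eq', Finset.mem_univ, if_true, nsmul_eq_mul]
    push_cast
    nlinarith
  have hone : absK (((Equiv.Perm.sign (1 : Equiv.Perm (Fin (n + 1))) : ℤ) : KInf F) *
      ∏ i, A ((1 : Equiv.Perm (Fin (n + 1))) i) i) =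
      (Fintype.card F : ℝ) ^ ∑ j, rhoZ (P j) j := by
    rw [absK_perm_sign, hterm]
    rfl
  rw [eq_neg_of_add_eq_zero_left hdet, absK_neg] at hone
  refine hone.not_lt (absK_sum_lt _ _ (zpow_pos card_pos' _) fun σ hσ => ?_)
  rw [absK_perm_sign, hterm]
  exact zpow_lt_zpow_right₀ hq (hup σ (Finset.ne_of_mem_erase hσ))

/-- Small elements of the stabilizer are scalar. -/
lemma TightData.entry_eq_of_small (h : TightData k E B₀ g b v)
    (hk : 2 * (E * (n + 1) * (n + 1)) + (n + 1) * B₀ < k) (hB₀ : 0 ≤ B₀) {s : A1 F (n + 1)}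
    (hs : s ∈ stab (QuotientGroup.mk g : LatSpace F (n + 1))) (hsk : ∀ i, 2 * rhoZ s i ≤ k)
    (i j : Fin (n + 1)) : entry s i = entry s j := by
  have hE := h.near.nonneg
  have hEn : 0 ≤ E * n := by positivity
  have hEnn : 0 ≤ E * n * n := by positivity
  have hBn : 0 ≤ n * B₀ := by positivity
  obtain ⟨P, hP0, hPmem, hPle, hdet⟩ := exists_chain (F := F) h.near (by nlinarith)
  set A : Matrix (Fin (n + 1)) (Fin (n + 1)) (KInf F) := Matrix.of fun i j => entry (P j) i with hA
  have hzero : ∀ l, l ≠ 0 → (A.updateCol l (entry s)).det = 0 := by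
    intro l hl
    by_contra hne
    have hupd : A.updateCol l (entry s) =
        Matrix.of fun i j => entry (Function.update P l s j) i := by
      refine Matrix.ext fun i j => ?_
      by_cases hj : j = l
      · subst hj; simp
      · simp [hA, Matrix.updateCol_ne hj, Function.update_of_ne hj]
    rw [hupd] at hne
    have hl1 : 1 ≤ ((l : ℕ) : ℤ) := by
      have : (l : ℕ) ≠ 0 := fun h => hl (Fin.ext h)
      omega
    have hk0 : 0 < k := by nlinarith
    -- With the exponents `k j` of the chain, `2 ∑ k j = n (n+1) k` meets the lower bound up to
    -- bounded terms. Putting `s`, of exponent at most `k/2`, in place of `P l` with `l ≥ 1` saves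
    -- at least `k/2`, which is too much.
    have hbound := h.le_sum_of_det_ne_zero (by nlinarith) (γ := Function.update P l s)
      (B := fun j => k * ((j : ℕ) : ℤ) + E * (n + 1) - if j = l then k - k / 2 else 0)
      (fun j => by
        by_cases hj : j = l
        · subst hj; rwa [Function.update_self]
        · rw [Function.update_of_ne hj]; exact h.le_stab (hPmem j)) hne
      (fun i j => by
        by_cases hj : j = l
        · subst hj
          rw [Function.update_self, if_pos rfl]
          have h1 := hsk i
          have h2 : k ≤ k * ((j : ℕ) : ℤ) := le_mul_of_one_le_right hk0.le hl1
          have h3 : 0 ≤ E * ((n : ℤ) + 1) := by positivity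
          omega
        · rw [Function.update_of_ne hj, if_neg hj, sub_zero]
          exact hPle j i)
    have hsum : 2 * ∑ j : Fin (n + 1), ((j : ℕ) : ℤ) = n * (n + 1) := by
      have h1 := sum_perm_val (1 : Equiv.Perm (Fin (n + 1)))
      simp only [Equiv.Perm.coe_one, id, Finset.sum_sub_distrib, ← Finset.mul_sum, Finset.sum_const,
        Finset.card_univ, Fintype.card_fin, nsmul_eq_mul] at h1
      push_cast at h1
      linarith
    simp only [Finset.sum_sub_distrib, Finset.sum_add_distrib, Finset.sum_const, Finset.card_univ,
      Fintype.card_fin, Finset.sum_ite_eq', Finset.mem_univ, if_true, nsmul_eq_mul,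
      ← Finset.mul_sum] at hbound
    push_cast at hbound
    have h1 : k ≤ 2 * (k - k / 2) := by omega
    have h2 : 2 * (k * ∑ j : Fin (n + 1), ((j : ℕ) : ℤ)) = k * (n * (n + 1)) := by
      rw [← hsum]; ring
    nlinarith
  -- By Cramer's rule the entries of `s` form a multiple of the column of `P 0 = 1`, the all-ones
  -- vector.
  have hcr := Matrix.mulVec_cramer A (entry s)
  have hc : ∀ l, l ≠ 0 → A.cramer (entry s) l = 0 := fun l hl => by
    rw [Matrix.cramer_apply]; exact hzero l hl
  have hval : ∀ i, A.cramer (entry s) 0 = A.det * entry s i := by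
    intro i
    have h1 := congrFun hcr i
    rw [Matrix.mulVec, dotProduct, Finset.sum_eq_single 0 (fun l _ hl => by rw [hc l hl, mul_zero])
      (fun h => absurd (Finset.mem_univ _) h), Pi.smul_apply, smul_eq_mul, hA, Matrix.of_apply, hP0,
      entry_one, one_mul] at h1
    exact h1
  exact mul_left_cancel₀ hdet ((hval i).symm.trans (hval j))

lemma TightData.rhoZ_eq_zero_of_small (h : TightData k E B₀ g b v)
    (hk : 2 * (E * (n + 1) * (n + 1)) + (n + 1) * B₀ < k) (hB₀ : 0 ≤ B₀) {s : A1 F (n + 1)}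
    (hs : s ∈ stab (QuotientGroup.mk g : LatSpace F (n + 1))) (hsk : ∀ i, 2 * rhoZ s i ≤ k) :
    rhoZ s = 0 := by
  have heq : ∀ i, rhoZ s i = rhoZ s 0 := fun i => by
    rw [rhoZ, rhoZ, h.entry_eq_of_small hk hB₀ hs hsk i 0]
  have hsum := sum_rhoZ s
  rw [Finset.sum_congr rfl fun i _ => heq i] at hsum
  simp only [Finset.sum_const, Finset.card_univ, Fintype.card_fin, nsmul_eq_mul] at hsum
  have h0 : rhoZ s 0 = 0 := (mul_eq_zero.mp hsum).resolve_left (by positivity)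
  ext i
  rw [heq i, h0, Pi.zero_apply]

lemma projA1_eq_one_of_entry_eq {s : A1 F (n + 1)} (h : ∀ i j, entry s i = entry s j) :
    projA1 F (n + 1) s = 1 := by
  change Matrix.ProjGenLinGroup.mk (s : G F (n + 1)) = 1
  rw [Matrix.ProjGenLinGroup.mk_eq_one, Matrix.GeneralLinearGroup.center_eq_range_scalar]
  refine ⟨Units.mk0 (entry s 0) (entry_ne_zero s 0), Units.ext ?_⟩
  rw [val_eq_diagonal]
  change Matrix.scalar _ (entry s 0) = _
  rw [Matrix.scalar_apply]
  exact congrArg Matrix.diagonal (funext fun i => h 0 i)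

end Rigidity


/-! ### Visits of diagonal orbits to compact parts of the space of lattices -/

section Visits

variable {F : Type*} [Field F] [Fintype F] {n : ℕ}

/-- On a proper subspace some coordinate is never needed to compute the norm. -/
lemma exists_coord_of_ne_top (V : Submodule (KInf F) (Fin (n + 1) → KInf F)) (hV : V ≠ ⊤) :
    ∃ i₀, ∀ w ∈ V, w ≠ 0 → ∃ i, i ≠ i₀ ∧ absK (w i) = supNorm w := by
  obtain ⟨f, hf, hVf⟩ := Submodule.exists_le_ker_of_lt_top V (lt_top_iff_ne_top.mpr hV)
  let c : Fin (n + 1) → KInf F := fun i => f (Pi.single i 1)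
  have hfc : ∀ w, f w = ∑ i, c i * w i := by
    intro w
    rw [LinearMap.pi_apply_eq_sum_univ f w]
    exact Finset.sum_congr rfl fun i _ => by
      rw [smul_eq_mul, mul_comm]
      congr 2
      ext1 j
      simp [Pi.single_apply, eq_comm]
  -- Let `∑ c_i w_i = 0` on `V`, with `|c_{i₀}|` maximal. If `|w_i|` were maximal at `i₀` only, the
  -- term `c_{i₀} w_{i₀}` would strictly dominate a vanishing sum.
  obtain ⟨i₀, hi₀⟩ := exists_absK_eq_supNorm c
  have hc0 : c ≠ 0 := fun h => hf (LinearMap.ext fun w => by simp [hfc, h])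
  have hpos := supNorm_pos hc0
  refine ⟨i₀, fun w hw hw0 => ?_⟩
  by_contra! hcon
  have hlt : ∀ i, i ≠ i₀ → absK (w i) < supNorm w := fun i hi =>
    lt_of_le_of_ne (absK_le_supNorm w i) (hcon i hi)
  have hmax : absK (w i₀) = supNorm w := by
    obtain ⟨i, hi⟩ := exists_absK_eq_supNorm w
    by_cases h : i = i₀
    · rwa [← h]
    · exact absurd hi (hcon i h)
  have hsum : ∑ i, c i * w i = 0 := by
    rw [← hfc]
    exact LinearMap.mem_ker.mp (hVf hw)
  rw [← Finset.add_sum_erase _ _ (Finset.mem_univ i₀)] at hsum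
  have h1 : absK (c i₀ * w i₀) = supNorm c * supNorm w := by rw [absK_mul, hi₀, hmax]
  rw [eq_neg_of_add_eq_zero_left hsum, absK_neg] at h1
  refine h1.not_lt (absK_sum_lt _ _ (mul_pos hpos (supNorm_pos hw0)) fun i hi => ?_)
  rw [absK_mul]
  exact mul_lt_mul' (absK_le_supNorm c i) (hlt i (Finset.ne_of_mem_erase hi)) (absK_nonneg _) hpos

lemma latticeOf_mul_diag (a a' : A1 F n) (g : G F n) :
    ((a * a' : A1 F n) : G F n) * g = (a : G F n) * ((a' : G F n) * g) := by
  rw [Subgroup.coe_mul, mul_assoc]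

/-- A diagonal orbit along which the length of the shortest vector is bounded above contains a
lattice all of whose vectors are long. -/
lemma exists_long_shortest (g : G F (n + 1)) {N : ℤ}
    (hN : ∀ a : A1 F (n + 1), ∃ w ∈ latticeOf ((a : G F (n + 1)) * g), w ≠ 0 ∧
      supNorm w ≤ (Fintype.card F : ℝ) ^ N) :
    ∃ a : A1 F (n + 1),
      (Fintype.card F : ℝ) ^ (-((n : ℤ) + 1) ^ 2) ≤ ellG ((a : G F (n + 1)) * g) := by
  have hq := one_lt_card_real (F := F)
  set q : ℝ := (Fintype.card F : ℝ) with hqdef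
  have hq0 : 0 < q := one_pos.trans hq
  let P : ℤ → Prop := fun e => ∃ a : A1 F (n + 1),
    ∀ w ∈ latticeOf ((a : G F (n + 1)) * g), w ≠ 0 → q ^ e ≤ supNorm w
  have hbdd : ∃ b, ∀ e, P e → e ≤ b := by
    refine ⟨N, fun e he => ?_⟩
    obtain ⟨a, ha⟩ := he
    obtain ⟨w, hw, hw0, hwN⟩ := hN a
    exact (zpow_le_zpow_iff_right₀ hq).mp ((ha w hw hw0).trans hwN)
  have hne : ∃ e, P e := by
    obtain ⟨e, he⟩ := exists_le_supNorm (((1 : A1 F (n + 1)) : G F (n + 1)) * g)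
    exact ⟨e, 1, he⟩
  -- Choose the point of the orbit whose vectors have the largest lower bound `q^e`; the assumption
  -- on short vectors bounds `e` by `N`.
  obtain ⟨e, ⟨a, ha⟩, hmax⟩ := Int.exists_greatest_of_bdd hbdd hne
  refine ⟨a, ?_⟩
  set g' := (a : G F (n + 1)) * g with hg'
  let S : ℕ → Set (Fin (n + 1) → KInf F) := fun j =>
    {w | w ∈ latticeOf g' ∧ supNorm w ≤ q ^ (e + j * (n + 1))}
  let V : ℕ → Submodule (KInf F) (Fin (n + 1) → KInf F) := fun j => Submodule.span (KInf F) (S j)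
  have hmono : ∀ j, V j ≤ V (j + 1) := fun j => Submodule.span_mono fun w hw =>
    ⟨hw.1, hw.2.trans (zpow_le_zpow_right₀ hq.le (by push_cast; nlinarith))⟩
  -- If a proper span does not grow, some coordinate `i₀` is dispensable for all vectors in it.
  -- Acting by `b_{i₀}` then lengthens these by a factor of at least `q`; all other vectors are
  -- longer than `q^(e+n+1)` and shrink by at most `q^n`. This would improve `e` to `e + 1`.
  have hstable : ∀ j, V j = V (j + 1) → V j = ⊤ := by
    intro j hj
    by_contra hV
    obtain ⟨i₀, hi₀⟩ := exists_coord_of_ne_top (V j) hV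
    have hbig : P (e + 1) := by
      refine ⟨stdVec F i₀ * a, fun w hw hw0 => ?_⟩
      rw [latticeOf_mul_diag, mem_latticeOf_diag_mul] at hw
      obtain ⟨w', hw', rfl⟩ := hw
      have hw'0 : w' ≠ 0 := fun h => hw0 (by ext1 i; simp [h])
      by_cases hsmall : supNorm w' ≤ q ^ (e + ((j + 1 : ℕ) : ℤ) * (n + 1))
      · have hmem : w' ∈ V j := by
          rw [hj]
          exact Submodule.subset_span ⟨hw', hsmall⟩
        obtain ⟨i, hii₀, hi⟩ := hi₀ w' hmem hw'0
        refine le_trans ?_ (absK_le_supNorm _ i)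
        rw [absK_mul, absK_entry, hi, rhoZ_stdVec, if_neg hii₀, sub_zero, ← hqdef, add_comm,
          zpow_add₀ hq0.ne']
        exact mul_le_mul_of_nonneg_left (ha w' hw' hw'0) (zpow_nonneg hq0.le _)
      · obtain ⟨i, hi⟩ := exists_absK_eq_supNorm w'
        refine le_trans ?_ (absK_le_supNorm _ i)
        rw [absK_mul, absK_entry, hi, ← hqdef]
        have h1 : q ^ (-(n : ℤ)) ≤ q ^ rhoZ (stdVec F i₀) i := by
          refine zpow_le_zpow_right₀ hq.le ?_
          rw [rhoZ_stdVec]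
          split_ifs <;> omega
        have h2 : q ^ (e + (n + 1)) ≤ supNorm w' := by
          refine le_trans (zpow_le_zpow_right₀ hq.le ?_) (not_le.mp hsmall).le
          push_cast
          nlinarith
        calc q ^ (e + 1) = q ^ (-(n : ℤ)) * q ^ (e + (n + 1)) := by
              rw [← zpow_add₀ hq0.ne']; congr 1; ring
          _ ≤ _ := mul_le_mul h1 h2 (zpow_nonneg hq0.le _) (zpow_nonneg hq0.le _)
    have := hmax _ hbig
    omega
  -- The span gains a dimension at each step until it is everything. There are therefore `n + 1`
  -- independent lattice vectors of norm at most `q^(e + (n+1)²)`, which bounds the covolume from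
  -- above.
  have hrank : ∀ j : ℕ, V j = ⊤ ∨ j ≤ Module.finrank (KInf F) (V j) := by
    intro j
    induction j with
    | zero => exact Or.inr (Nat.zero_le _)
    | succ j ih =>
      rcases ih with h | h
      · exact Or.inl (top_le_iff.mp (h ▸ hmono j))
      · by_cases heq : V j = V (j + 1)
        · exact Or.inl (heq ▸ hstable j heq)
        · exact Or.inr (h.trans_lt (Submodule.finrank_lt_finrank_of_lt
            (lt_of_le_of_ne (hmono j) heq)))
  have htop : V (n + 1) = ⊤ := by
    rcases hrank (n + 1) with h | h
    · exact h
    · exact Submodule.eq_top_of_finrank_eq (le_antisymm (Submodule.finrank_le _) (by simpa using h))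
  obtain ⟨f, hfS, -, hfind⟩ := Submodule.exists_fun_fin_finrank_span_eq (KInf F) (S (n + 1))
  have hfin : Module.finrank (KInf F) (Submodule.span (KInf F) (S (n + 1))) = n + 1 := by
    change Module.finrank (KInf F) (V (n + 1)) = n + 1
    rw [htop, finrank_top]
    simp
  let f' : Fin (n + 1) → Fin (n + 1) → KInf F := fun j => f (Fin.cast hfin.symm j)
  have hf'ind : LinearIndependent (KInf F) f' := hfind.comp _ (Fin.cast_injective _)
  let A : Matrix (Fin (n + 1)) (Fin (n + 1)) (KInf F) := Matrix.of fun i j => f' j i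
  have hdet : A.det ≠ 0 := by
    have h : IsUnit A.transpose := Matrix.linearIndependent_rows_iff_isUnit.mp hf'ind
    rw [Matrix.isUnit_iff_isUnit_det, Matrix.det_transpose] at h
    exact h.ne_zero
  have hdet1 : absK g'.val.det ≤ q ^ ((n + 1 : ℤ) * (e + (n + 1) ^ 2)) := by
    refine (det_le_of_mem_latticeOf g' A hdet fun j => (hfS _).1).trans ?_
    refine (absK_det_le A (fun _ => q ^ (e + (n + 1) ^ 2)) fun i j => ?_).trans ?_
    · refine (absK_le_supNorm (f' j) i).trans ((hfS _).2.trans (le_of_eq ?_))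
      push_cast
      ring_nf
    · simp only [Finset.prod_const, Finset.card_univ, Fintype.card_fin]
      rw [← zpow_natCast, ← zpow_mul]
      push_cast
      exact le_of_eq (by ring_nf)
  rw [le_ellG_iff]
  intro w hw hw0
  refine le_trans ?_ (ha w hw hw0)
  have hD : absK g'.val.det ^ (1 / ((n : ℝ) + 1)) ≤ q ^ (e + (n + 1 : ℤ) ^ 2) := by
    refine (Real.rpow_le_rpow (absK_nonneg _) hdet1 (by positivity)).trans (le_of_eq ?_)
    rw [mul_comm, zpow_mul, ← Real.rpow_intCast (q ^ _), ← Real.rpow_mul (zpow_nonneg hq0.le _)]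
    have : (((n : ℤ) + 1 : ℤ) : ℝ) * (1 / ((n : ℝ) + 1)) = 1 := by
      push_cast
      field_simp
    rw [this, Real.rpow_one]
  calc q ^ (-((n : ℤ) + 1) ^ 2) * absK g'.val.det ^ (1 / ((n : ℝ) + 1))
      ≤ q ^ (-((n : ℤ) + 1) ^ 2) * q ^ (e + (n + 1 : ℤ) ^ 2) :=
        mul_le_mul_of_nonneg_left hD (zpow_nonneg hq0.le _)
    _ = q ^ e := by rw [← zpow_add₀ hq0.ne']; congr 1; ring

variable {k E B₀ : ℤ} {g : G F (n + 1)} {b : Fin (n + 1) → A1 F (n + 1)} {v : Fin (n + 1) → KInf F}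

/-- The vector is `a γ v`, up to a unit scalar. These test vectors are the only ones needed both to
bound the shortest length along the orbit and to locate the visits. -/
lemma TightData.exists_mem_latticeOf (h : TightData k E B₀ g b v) (a : A1 F (n + 1))
    {γ : A1 F (n + 1)} (hγ : γ ∈ stab (QuotientGroup.mk g : LatSpace F (n + 1))) :
    ∃ w ∈ latticeOf ((a : G F (n + 1)) * g), w ≠ 0 ∧
      ∃ i, supNorm w ≤ (Fintype.card F : ℝ) ^ rhoZ (a * γ) i * supNorm v := by
  obtain ⟨z, hz, hmem⟩ := exists_scalar_of_mem_stab hγ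
  have hz0 : z ≠ 0 := fun h0 => by rw [h0, absK_zero] at hz; exact zero_ne_one hz
  refine ⟨_, mem_latticeOf_diag_mul.mpr ⟨_, hmem v h.mem, rfl⟩, ?_, ?_⟩
  · obtain ⟨j, hj⟩ := Function.ne_iff.mp h.ne_zero
    exact Function.ne_iff.mpr ⟨j, mul_ne_zero (entry_ne_zero _ _)
      (mul_ne_zero (mul_ne_zero hz0 (entry_ne_zero _ _)) hj)⟩
  · obtain ⟨i, hi⟩ := exists_absK_eq_supNorm (fun i => entry a i * (z * entry γ i * v i))
    refine ⟨i, ?_⟩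
    rw [← hi, absK_mul, absK_mul, absK_mul, hz, one_mul, ← mul_assoc, ← absK_mul, ← entry_mul,
      absK_entry]
    exact mul_le_mul_of_nonneg_left (absK_le_supNorm v i) (zpow_nonneg card_pos'.le _)

/-- Compact orbits with almost standard stabilizers visit a fixed compact set. -/
lemma TightData.exists_visit (h : TightData k E B₀ g b v) (hk : 8 * (n + 3) * (E + 1) ≤ k) :
    ∃ a : A1 F (n + 1), IsVisit ((Fintype.card F : ℝ) ^ (-((n : ℤ) + 1) ^ 2))
      (QuotientGroup.mk g : LatSpace F (n + 1)) a := by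
  have hE := h.near.nonneg
  have hk0 : 0 ≤ k := le_trans (by positivity) hk
  obtain ⟨e, he⟩ := exists_supNorm_eq_zpow h.ne_zero
  refine exists_long_shortest g (N := n * k + 2 * (n + 3) * (E + 1) + e) fun a => ?_
  obtain ⟨m, hm⟩ := h.near.reduce hk (rhoZ a) (sum_rhoZ a)
  obtain ⟨γ, hγ, hγm⟩ := exists_mem_genGroup_lin b m
  obtain ⟨w, hw, hw0, i, hi⟩ := h.exists_mem_latticeOf a (h.le_stab hγ)
  refine ⟨w, hw, hw0, hi.trans ?_⟩
  rw [he, ← zpow_add₀ card_pos'.ne']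
  refine zpow_le_zpow_right₀ one_lt_card_real.le ?_
  have h1 := hm i
  rw [← hγm, ← rhoZ_mul] at h1
  have h2 : 0 ≤ n * k + 2 * (n + 3) * (E + 1) := by positivity
  linarith

/-- Visits to the compact part only occur near the deep holes of the lattice of the simplex set. -/
lemma TightData.near_of_isVisit (h : TightData k E B₀ g b v) (hk : 8 * (n + 3) * (E + 1) ≤ k)
    {B : ℤ} (hB : 0 ≤ B) (hk' : B + 2 * (E * (n + 1)) < k) {δ : ℝ} (hδ : 0 < δ)
    (hδB : (Fintype.card F : ℝ) ^ (B₀ - B) ≤ δ ^ 2) (i₀ : Fin (n + 1)) {a : A1 F (n + 1)}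
    (ha : IsVisit δ (QuotientGroup.mk g : LatSpace F (n + 1)) a) :
    ∃ γ ∈ genGroup b, ∃ p : Equiv.Perm (Fin (n + 1)), p i₀ = Fin.last n ∧
      Near k (rhoZ (a * γ)) p (holeRadius n E B) := by
  have hq := one_lt_card_real (F := F)
  have hq0 := card_pos' (F := F)
  have key : ∀ m, ∃ i, n * k - B ≤ 2 * (rhoZ a + lin (fun l => rhoZ (b l)) m) i := by
    intro m
    obtain ⟨γ, hγ, hγm⟩ := exists_mem_genGroup_lin b m
    obtain ⟨w, hw, hw0, i, hi⟩ := h.exists_mem_latticeOf a (h.le_stab hγ)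
    refine ⟨i, ?_⟩
    rw [← hγm, ← rhoZ_mul]
    -- The test vector must have normalized length at least `δ`, so `δ ≤ q^(ρ(aγ)_i) ℓ(g)`. After
    -- squaring, tightness and `q^(B₀ - B) ≤ δ²` give `2 ρ(aγ)_i ≥ n k - B`.
    have h1 := (le_ellG_iff.mp (show δ ≤ ellG ((a : G F (n + 1)) * g) from ha) w hw hw0).trans hi
    rw [det_diag_mul, h.supNorm_eq, ← mul_assoc] at h1
    have h2 := le_of_mul_le_mul_right h1 (Real.rpow_pos_of_pos (absK_det_pos g) _)
    have h3 : δ ^ 2 ≤ ((Fintype.card F : ℝ) ^ rhoZ (a * γ) i) ^ 2 * ellG g ^ 2 := by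
      rw [← mul_pow]
      exact pow_le_pow_left₀ hδ.le h2 2
    have h4 : (Fintype.card F : ℝ) ^ (B₀ - B) * (Fintype.card F : ℝ) ^ (n * k - B₀) ≤
        ((Fintype.card F : ℝ) ^ rhoZ (a * γ) i) ^ 2 := by
      have h5 := mul_le_mul_of_nonneg_right (hδB.trans h3)
        (zpow_nonneg hq0.le (n * k - B₀))
      rw [mul_assoc] at h5
      exact h5.trans (mul_le_of_le_one_right (by positivity) h.tight)
    rw [← zpow_add₀ hq0.ne', ← zpow_natCast, ← zpow_mul] at h4
    have h5 := (zpow_le_zpow_iff_right₀ hq).mp h4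
    push_cast at h5
    linarith
  obtain ⟨m, p, hp, hnear⟩ := h.near.near_hole hk hk' hB (rhoZ a) (sum_rhoZ a) i₀ key
  obtain ⟨γ, hγ, hγm⟩ := exists_mem_genGroup_lin b m
  exact ⟨γ, hγ, p, hp, by rwa [rhoZ_mul, hγm]⟩

lemma IsVisit.mul_stab {δ : ℝ} {x : LatSpace F (n + 1)} {a s : A1 F (n + 1)} (ha : IsVisit δ x a)
    (hs : s ∈ stab x) : IsVisit δ x (a * s) := by
  rw [IsVisit, mul_smul, MulAction.mem_stabilizer_iff.mp hs]
  exact ha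

end Visits


/-! ### Index estimates -/

section Index

/-- Each fibre of `f` lies in one left coset, so `f` separates coset representatives. As an infinite
index counts as `0`, the first conjunct records finiteness. -/
lemma index_le_card_of_map {G₀ : Type*} [Group G₀] (H : Subgroup G₀) {α : Type*} [Fintype α]
    (f : G₀ → α) (hf : ∀ a b, f a = f b → a⁻¹ * b ∈ H) :
    H.index ≠ 0 ∧ H.index ≤ Fintype.card α := by
  have hinj : Function.Injective fun x : G₀ ⧸ H => f x.out := by
    intro x y hxy
    have h := QuotientGroup.eq.mpr (hf _ _ hxy)
    rwa [QuotientGroup.out_eq', QuotientGroup.out_eq'] at h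
  have : Finite (G₀ ⧸ H) := Finite.of_injective _ hinj
  refine ⟨Subgroup.index_ne_zero_of_finite, ?_⟩
  rw [Subgroup.index, ← Nat.card_eq_fintype_card]
  exact Nat.card_le_card_of_injective _ hinj

lemma relIndex_le_card_of_map {G₀ : Type*} [Group G₀] (H K : Subgroup G₀) {α : Type*} [Fintype α]
    (f : K → α) (hf : ∀ a b, f a = f b → (a : G₀)⁻¹ * b ∈ H) :
    H.relIndex K ≠ 0 ∧ H.relIndex K ≤ Fintype.card α :=
  index_le_card_of_map (H.subgroupOf K) f fun a b hab => Subgroup.mem_subgroupOf.mpr (hf a b hab)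

end Index

/-! ### Deep holes and permutations -/

section Holes

variable {F : Type*} [Field F] [Fintype F] {n : ℕ}

lemma extPerm_last (τ : Equiv.Perm (Fin n)) : extPerm τ (Fin.last n) = Fin.last n := by
  simp [extPerm]

lemma extPerm_castSucc (τ : Equiv.Perm (Fin n)) (i : Fin n) :
    extPerm τ i.castSucc = (τ i).castSucc := by
  simp [extPerm]

lemma extPerm_bijective (τ : Equiv.Perm (Fin n)) : Function.Bijective (extPerm τ) := by
  refine Finite.injective_iff_bijective.mp fun i j hij => ?_
  induction i using Fin.lastCases with
  | last =>
    induction j using Fin.lastCases with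
    | last => rfl
    | cast j =>
      rw [extPerm_last, extPerm_castSucc] at hij
      exact absurd hij.symm (Fin.castSucc_lt_last _).ne
  | cast i =>
    induction j using Fin.lastCases with
    | last =>
      rw [extPerm_last, extPerm_castSucc] at hij
      exact absurd hij (Fin.castSucc_lt_last _).ne
    | cast j =>
      rw [extPerm_castSucc, extPerm_castSucc] at hij
      rw [τ.injective (Fin.castSucc_injective n hij)]

/-- The positions of the coordinates at the deep hole `w_τ`, if `t_j` has its negative coordinate
at `π j`. -/
noncomputable def holePerm (π : Equiv.Perm (Fin (n + 1))) (τ : Equiv.Perm (Fin n)) :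
    Equiv.Perm (Fin (n + 1)) :=
  ((Equiv.ofBijective _ (extPerm_bijective τ)).trans π).symm

lemma holePerm_apply (π : Equiv.Perm (Fin (n + 1))) (τ : Equiv.Perm (Fin n)) (l : Fin (n + 1)) :
    holePerm π τ (π (extPerm τ l)) = l := by
  rw [holePerm, Equiv.symm_apply_eq]
  rfl

lemma holePerm_last (π : Equiv.Perm (Fin (n + 1))) (τ : Equiv.Perm (Fin n)) :
    holePerm π τ (π (Fin.last n)) = Fin.last n := by
  conv_lhs => rw [← extPerm_last τ]
  exact holePerm_apply π τ _

/-- The permutations `τ` of `n` elements account for all vertices of the permutohedron normalized at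
`π (Fin.last n)`, so there are `n!` classes of holes. -/
lemma exists_holePerm_eq (π : Equiv.Perm (Fin (n + 1))) (p : Equiv.Perm (Fin (n + 1)))
    (hp : p (π (Fin.last n)) = Fin.last n) : ∃ τ, holePerm π τ = p := by
  let σ : Equiv.Perm (Fin (n + 1)) := p.symm.trans π.symm
  have hσ : σ (Fin.last n) = Fin.last n := by
    simp only [σ, Equiv.trans_apply]
    rw [Equiv.symm_apply_eq, Equiv.symm_apply_eq, hp]
  have hne : ∀ i : Fin n, σ i.castSucc ≠ Fin.last n := fun i h =>
    (Fin.castSucc_lt_last i).ne (σ.injective (h.trans hσ.symm))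
  let τ₀ : Fin n → Fin n := fun i => (σ i.castSucc).castPred (hne i)
  have hτ₀ : Function.Injective τ₀ := fun i j hij => by
    have h : σ i.castSucc = σ j.castSucc := by
      rw [← Fin.castSucc_castPred _ (hne i), ← Fin.castSucc_castPred _ (hne j)]
      exact congrArg Fin.castSucc hij
    exact Fin.castSucc_injective n (σ.injective h)
  refine ⟨Equiv.ofBijective τ₀ (Finite.injective_iff_bijective.mp hτ₀), Equiv.ext fun i => ?_⟩
  have hext : ∀ l, extPerm (Equiv.ofBijective τ₀ (Finite.injective_iff_bijective.mp hτ₀)) l =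
      σ l := by
    intro l
    induction l using Fin.lastCases with
    | last => rw [extPerm_last, hσ]
    | cast l => rw [extPerm_castSucc]; simp [τ₀]
  have h := holePerm_apply π (Equiv.ofBijective τ₀ (Finite.injective_iff_bijective.mp hτ₀)) (p i)
  rw [hext] at h
  simpa [σ] using h

lemma holePerm_injective (π : Equiv.Perm (Fin (n + 1))) : Function.Injective (holePerm π) := by
  intro τ τ' h
  refine Equiv.ext fun i => Fin.castSucc_injective n ?_
  rw [← extPerm_castSucc, ← extPerm_castSucc]
  refine π.injective ((holePerm π τ).injective ?_)
  rw [holePerm_apply, h, holePerm_apply]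

/-- The points `w_τ` are close to vertices of the permutohedron. -/
lemma wVec_close {k E : ℤ} {t b : Fin (n + 1) → A1 F (n + 1)} {π : Equiv.Perm (Fin (n + 1))}
    (htb : ∀ j, t j = b (π j)) (hu : NearStd k E fun l => rhoZ (b l)) (τ : Equiv.Perm (Fin n))
    (i : Fin (n + 1)) :
    |2 * wVec t τ i - (k : ℝ) * (n - 2 * ((holePerm π τ i : ℕ) : ℝ))| ≤ n * E := by
  set p := holePerm π τ with hp
  have hd : (0 : ℝ) < (n : ℝ) + 1 := by positivity
  have hsum : ∑ l : Fin (n + 1), ((l : ℕ) : ℝ) * 2 = n * (n + 1) := by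
    have h1 := sum_perm_val (1 : Equiv.Perm (Fin (n + 1)))
    simp only [Equiv.Perm.coe_one, id, Finset.sum_sub_distrib, ← Finset.mul_sum, Finset.sum_const,
      Finset.card_univ, Fintype.card_fin, nsmul_eq_mul] at h1
    have h2 := congrArg (Int.cast : ℤ → ℝ) h1
    push_cast at h2
    rw [← Finset.sum_mul]
    linarith
  have hterm : ∀ l : Fin (n + 1), |(l : ℝ) * rhoVec (t (extPerm τ l)) i -
      (l : ℝ) * (k - if l = p i then ((n : ℝ) + 1) * k else 0)| ≤ (l : ℝ) * E := by
    intro l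
    have h := hu.close (π (extPerm τ l)) i
    have hiff : i = π (extPerm τ l) ↔ l = p i := by
      constructor
      · rintro h
        rw [h, hp, holePerm_apply]
      · intro h
        apply p.injective
        rw [hp, holePerm_apply, ← hp, h]
    have h' : |rhoVec (t (extPerm τ l)) i - (k - if l = p i then ((n : ℝ) + 1) * k else 0)| ≤
        (E : ℝ) := by
      rw [rhoVec_eq, htb]
      simp only [hiff] at h
      exact_mod_cast h
    rw [← mul_sub, abs_mul, abs_of_nonneg (by positivity : (0 : ℝ) ≤ (l : ℝ))]
    exact mul_le_mul_of_nonneg_left h' (by positivity)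
  -- For unperturbed vectors, coordinate `i` of `(n+1) w_τ` is `∑ l k = n (n+1) k / 2`, less `(n+1)
  -- k l` for the one `l` whose vector is negative at `i`, which is `l = p i`.
  have hmain : ∑ l : Fin (n + 1), (l : ℝ) * (k - if l = p i then ((n : ℝ) + 1) * k else 0) =
      ((n : ℝ) + 1) * (k * (n - 2 * ((p i : ℕ) : ℝ))) / 2 := by
    simp only [mul_sub, Finset.sum_sub_distrib, mul_ite, mul_zero, Finset.sum_ite_eq',
      Finset.mem_univ, if_true, ← Finset.sum_mul]
    rw [← Finset.sum_mul] at hsum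
    have : ∑ l : Fin (n + 1), ((l : ℕ) : ℝ) = n * (n + 1) / 2 := by linarith
    rw [this]
    ring
  have herr := (Finset.abs_sum_le_sum_abs (fun l : Fin (n + 1) => (l : ℝ) *
    rhoVec (t (extPerm τ l)) i - (l : ℝ) * (k - if l = p i then ((n : ℝ) + 1) * k else 0))
    Finset.univ).trans (Finset.sum_le_sum fun l _ => hterm l)
  rw [Finset.sum_sub_distrib, hmain, ← Finset.sum_mul] at herr
  have hs : ∑ l : Fin (n + 1), ((l : ℕ) : ℝ) = n * (n + 1) / 2 := by
    rw [← Finset.sum_mul] at hsum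
    linarith
  rw [hs] at herr
  have heq : 2 * wVec t τ i - (k : ℝ) * (n - 2 * ((p i : ℕ) : ℝ)) = 2 / ((n : ℝ) + 1) *
      (∑ l : Fin (n + 1), (l : ℝ) * rhoVec (t (extPerm τ l)) i -
        ((n : ℝ) + 1) * (k * (n - 2 * ((p i : ℕ) : ℝ))) / 2) := by
    rw [wVec]
    field_simp
  rw [heq, abs_mul, abs_of_nonneg (by positivity : (0 : ℝ) ≤ 2 / ((n : ℝ) + 1))]
  calc 2 / ((n : ℝ) + 1) * _ ≤ 2 / ((n : ℝ) + 1) * (n * (n + 1) / 2 * E) :=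
        mul_le_mul_of_nonneg_left herr (by positivity)
    _ = n * E := by field_simp

lemma sum_wVec (t : Fin (n + 1) → A1 F (n + 1)) (τ : Equiv.Perm (Fin n)) :
    ∑ i, wVec t τ i = 0 := by
  unfold wVec
  rw [← Finset.mul_sum, Finset.sum_comm]
  refine mul_eq_zero_of_right _ (Finset.sum_eq_zero fun l _ => ?_)
  rw [← Finset.mul_sum]
  refine mul_eq_zero_of_right _ ?_
  simp only [rhoVec_eq]
  exact_mod_cast sum_rhoZ (t (extPerm τ l))

/-- The ball is bounded from above only. Since coordinate sums vanish, coordinates can fall below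
the centre by at most `n r`, which explains the `2 n r` after doubling; `n E` is the distance from
`w_τ` to the ideal vertex. -/
lemma near_of_mem_rhoBall {k E : ℤ} {t b : Fin (n + 1) → A1 F (n + 1)}
    {π : Equiv.Perm (Fin (n + 1))} (hn : 1 ≤ n)
    (htb : ∀ j, t j = b (π j)) (hu : NearStd k E fun l => rhoZ (b l)) (τ : Equiv.Perm (Fin n))
    {r : ℝ} (hr : 0 ≤ r) {a : A1 F (n + 1)} (ha : a ∈ rhoBall r (wVec t τ)) {D : ℤ}
    (hD : 2 * n * r + n * E ≤ D) : Near k (rhoZ a) (holePerm π τ) D := by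
  have hup : ∀ i, rhoVec a i - wVec t τ i ≤ r := fun i =>
    (le_ciSup (f := fun i => (rhoVec a - wVec t τ) i) (Set.finite_range _).bddAbove i).trans ha
  have hsum : ∑ i, (rhoVec a i - wVec t τ i) = 0 := by
    rw [Finset.sum_sub_distrib, sum_wVec, sub_zero]
    simp only [rhoVec_eq]
    exact_mod_cast sum_rhoZ a
  have hn' : (1 : ℝ) ≤ n := by exact_mod_cast hn
  have hlow : ∀ i, -(n * r) ≤ rhoVec a i - wVec t τ i := by
    intro i
    rw [Fin.sum_univ_succAbove _ i] at hsum
    have := Finset.sum_le_card_nsmul Finset.univ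
      (fun j => rhoVec a (i.succAbove j) - wVec t τ (i.succAbove j)) r (fun j _ => hup _)
    simp only [Finset.card_univ, Fintype.card_fin, nsmul_eq_mul] at this
    linarith
  intro i
  have h1 := abs_le.mp (wVec_close htb hu τ i)
  have h2 := hup i
  have h3 := hlow i
  rw [rhoVec_eq] at h2 h3
  have h4 : r ≤ n * r := le_mul_of_one_le_left hr hn'
  have h5 : |2 * (rhoZ a i : ℝ) - (k : ℝ) * (n - 2 * ((holePerm π τ i : ℕ) : ℝ))| ≤ D := by
    rw [abs_le]
    constructor <;> linarith
  exact_mod_cast h5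

end Holes

/-! ### The stabilizer and the visits of a tight lattice -/

section Structure

variable {F : Type*} [Field F] [Fintype F] {n : ℕ}
  {k E B₀ B : ℤ} {g : G F (n + 1)} {b : Fin (n + 1) → A1 F (n + 1)} {v : Fin (n + 1) → KInf F}
  {i₀ : Fin (n + 1)} {δ : ℝ}

/-- `k` is large in terms of `E`, `B₀` and `B`. -/
structure Large (n : ℕ) (k E B₀ B : ℤ) : Prop where
  nonneg : 0 ≤ B₀
  nonneg' : 0 ≤ B
  reduce : 8 * (n + 3) * (E + 1) ≤ k
  hole : B + 2 * (E * (n + 1)) < k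
  rigid : 2 * (E * (n + 1) * (n + 1)) + (n + 1) * B₀ < k
  exact : 2 * (2 * (2 * n) + 1) * E + 2 * E + 1 ≤ k
  radius : 8 * holeRadius n E B ≤ k
  dim : 4 * n ≤ k

lemma Large.separate (hL : Large n k E B₀ B) (hE : 0 ≤ E) :
    2 * (2 * n + 1) * E + 2 * E + 1 ≤ k := by
  have := hL.exact
  have : 0 ≤ n * E := by positivity
  linarith

lemma Near.mono {z : Fin (n + 1) → ℤ} {p : Equiv.Perm (Fin (n + 1))} {D D' : ℤ}
    (h : Near k z p D) (hD : D ≤ D') : Near k z p D' := fun i => (h i).trans hD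

/-- The holes near which the translates of one visit lie distinguish the elements of the stabilizer
modulo the simplex group. -/
lemma TightData.relIndex_le (h : TightData k E B₀ g b v) (hL : Large n k E B₀ B)
    (hB : B₀ + 2 * (n + 1) ^ 2 ≤ B) :
    ((genGroup b).map (projA1 F (n + 1))).relIndex
        ((stab (QuotientGroup.mk g : LatSpace F (n + 1))).map (projA1 F (n + 1))) ≠ 0 ∧
      ((genGroup b).map (projA1 F (n + 1))).relIndex
        ((stab (QuotientGroup.mk g : LatSpace F (n + 1))).map (projA1 F (n + 1))) ≤
          n.factorial := by
  have hE := h.near.nonneg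
  have hq := one_lt_card_real (F := F)
  obtain ⟨a, ha⟩ := h.exists_visit hL.reduce
  have hhole : ∀ s ∈ stab (QuotientGroup.mk g : LatSpace F (n + 1)), ∃ τ : Equiv.Perm (Fin n),
      ∃ γ ∈ genGroup b, Near k (rhoZ (a * s * γ)) (holePerm 1 τ) (holeRadius n E B) := by
    intro s hs
    obtain ⟨γ, hγ, p, hp, hnear⟩ := h.near_of_isVisit hL.reduce hL.nonneg' hL.hole
      (zpow_pos card_pos' _) (by
        rw [← zpow_natCast, ← zpow_mul]
        refine zpow_le_zpow_right₀ hq.le ?_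
        push_cast
        linarith) (Fin.last n) (ha.mul_stab hs)
    obtain ⟨τ, rfl⟩ := exists_holePerm_eq 1 p hp
    exact ⟨τ, γ, hγ, hnear⟩
  choose! τ γ hγ hnear using hhole
  choose s hs hsx using fun x : (stab (QuotientGroup.mk g : LatSpace F (n + 1))).map
    (projA1 F (n + 1)) => Subgroup.mem_map.mp x.2
  have hcard : Fintype.card (Equiv.Perm (Fin n)) = n.factorial := by
    rw [Fintype.card_perm, Fintype.card_fin]
  rw [← hcard]
  refine relIndex_le_card_of_map _ _ (fun x => τ (s x)) fun x y hxy => ?_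
  have hx := hnear _ (hs x)
  have hy := hnear _ (hs y)
  rw [hxy] at hx
  -- Both translates of the visit `a` lie near the same hole, and `ρ(a)` cancels in the quotient
  -- `u`; so `u` is small, hence scalar by rigidity.
  set u := (s x * γ (s x))⁻¹ * (s y * γ (s y)) with hu
  have hstab : u ∈ stab (QuotientGroup.mk g : LatSpace F (n + 1)) :=
    mul_mem (inv_mem (mul_mem (hs x) (h.le_stab (hγ _ (hs x)))))
      (mul_mem (hs y) (h.le_stab (hγ _ (hs y))))
  have hsmall : ∀ i, 2 * rhoZ u i ≤ k := by
    intro i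
    have h1 := (abs_le.mp (hx i)).1
    have h2 := (abs_le.mp (hy i)).2
    have h3 := hL.radius
    have h4 : 0 ≤ holeRadius n E B := (abs_nonneg _).trans (hx i)
    simp only [hu, rhoZ_mul, rhoZ_inv, Pi.add_apply, Pi.neg_apply] at h1 h2 ⊢
    linarith
  have hproj := projA1_eq_one_of_entry_eq
    (h.entry_eq_of_small hL.rigid hL.nonneg hstab hsmall)
  have hγproj : ∀ s' ∈ stab (QuotientGroup.mk g : LatSpace F (n + 1)),
      projA1 F (n + 1) (γ s') ∈ (genGroup b).map (projA1 F (n + 1)) := fun s' hs' =>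
    Subgroup.mem_map_of_mem _ (hγ s' hs')
  have heq : ((x : Matrix.ProjGenLinGroup (Fin (n + 1)) (KInf F)))⁻¹ * y =
      projA1 F (n + 1) (γ (s x)) * (projA1 F (n + 1) (γ (s y)))⁻¹ := by
    rw [← hsx x, ← hsx y]
    simp only [hu, map_mul, map_inv, mul_inv_rev] at hproj
    rw [eq_mul_inv_iff_mul_eq, ← mul_right_inj (projA1 F (n + 1) (γ (s x)))⁻¹]
    simpa [mul_assoc] using hproj
  rw [heq]
  exact mul_mem (hγproj _ (hs x)) (inv_mem (hγproj _ (hs y)))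

/-- If all deep holes are visited, then no translation outside the simplex group preserves the
visits. -/
lemma TightData.exists_mul_rhoZ_eq_zero (h : TightData k E B₀ g b v) (hL : Large n k E B₀ B)
    (hδ : 0 < δ) (hδB : (Fintype.card F : ℝ) ^ (B₀ - B) ≤ δ ^ 2) {D : ℤ} (hD : 8 * D ≤ k)
    (hvis : ∀ p : Equiv.Perm (Fin (n + 1)), p i₀ = Fin.last n → ∃ a : A1 F (n + 1),
      IsVisit δ (QuotientGroup.mk g : LatSpace F (n + 1)) a ∧ Near k (rhoZ a) p D)
    {s : A1 F (n + 1)} (hs : s ∈ stab (QuotientGroup.mk g : LatSpace F (n + 1))) :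
    ∃ γ ∈ genGroup b, rhoZ (s * γ) = 0 := by
  have hE := h.near.nonneg
  have hR := hL.radius
  set R := holeRadius n E B with hRdef
  -- Any normalized hole would serve. Its translate by `s` is again near a hole `p₁`, so that `ρ(s')
  -- ≈ k (p₀ - p₁)` after a correction by `γ₀`.
  set p₀ : Equiv.Perm (Fin (n + 1)) := Equiv.swap i₀ (Fin.last n) with hp₀
  have hp₀' : p₀ i₀ = Fin.last n := Equiv.swap_apply_left _ _
  obtain ⟨a₀, ha₀, hnear₀⟩ := hvis p₀ hp₀'
  obtain ⟨γ₀, hγ₀, p₁, hp₁, hnear₁⟩ := h.near_of_isVisit hL.reduce hL.nonneg' hL.hole hδ hδB i₀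
    (ha₀.mul_stab hs)
  set s' := s * γ₀ with hs'
  have hs'stab : s' ∈ stab (QuotientGroup.mk g : LatSpace F (n + 1)) :=
    mul_mem hs (h.le_stab hγ₀)
  rw [mul_assoc, rhoZ_mul, ← hs'] at hnear₁
  have hshift : ∀ i, |2 * rhoZ s' i - 2 * (k * (((p₀ i : ℕ) : ℤ) - ((p₁ i : ℕ) : ℤ)))| ≤ D + R := by
    intro i
    have h1 := abs_le.mp (hnear₀ i)
    have h2 := abs_le.mp (hnear₁ i)
    rw [Pi.add_apply] at h2
    rw [abs_le]
    constructor <;> linarith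
  have hval : ∀ (p : Equiv.Perm (Fin (n + 1))) i, ((p i : ℕ) : ℤ) ≤ n ∧ 0 ≤ ((p i : ℕ) : ℤ) :=
    fun p i => by
      have := (p i).is_lt
      omega
  have hpeq : ∀ i, p₀ i = p₁ i := by
    intro i₁
    by_contra hne
    have hi : i₁ ≠ i₀ := fun hi => hne (by rw [hi, hp₀', hp₁])
    -- Suppose the shift is nonzero at `i₁`. Choose a hole `p₂` whose rank at `i₁` is `c ≡ n + p₀ i₁
    -- - p₁ i₁` modulo `n + 1`. Its translate would be a hole with `p₃ i₁ ≡ c - p₀ i₁ + p₁ i₁ ≡ n`,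
    -- the rank already held by `i₀`.
    obtain ⟨c, hcn, e, hce⟩ : ∃ c : Fin (n + 1), c ≠ Fin.last n ∧ ∃ e : ℤ, ((c : ℕ) : ℤ) =
        n + (((p₀ i₁ : ℕ) : ℤ) - ((p₁ i₁ : ℕ) : ℤ)) - (n + 1) * e := by
      have h0 := hval p₀ i₁
      have h1 := hval p₁ i₁
      have hv : (p₀ i₁ : ℕ) ≠ (p₁ i₁ : ℕ) := fun hv => hne (Fin.ext hv)
      rcases lt_or_gt_of_ne hv with hlt | hlt
      · refine ⟨⟨n - ((p₁ i₁ : ℕ) - (p₀ i₁ : ℕ)), by omega⟩, fun hc => ?_, 0, ?_⟩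
        · have := congrArg Fin.val hc
          simp only [Fin.val_last] at this
          omega
        · push_cast
          omega
      · refine ⟨⟨(p₀ i₁ : ℕ) - (p₁ i₁ : ℕ) - 1, by omega⟩, fun hc => ?_, 1, ?_⟩
        · have := congrArg Fin.val hc
          simp only [Fin.val_last] at this
          omega
        · push_cast
          omega
    set p₂ : Equiv.Perm (Fin (n + 1)) := p₀.trans (Equiv.swap (p₀ i₁) c) with hp₂
    have hp₂i₀ : p₂ i₀ = Fin.last n := by
      rw [hp₂, Equiv.trans_apply, hp₀']
      exact Equiv.swap_apply_of_ne_of_ne (fun heq => hi (p₀.injective (hp₀'.trans heq)).symm)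
        hcn.symm
    have hp₂i₁ : p₂ i₁ = c := by
      rw [hp₂, Equiv.trans_apply, Equiv.swap_apply_left]
    obtain ⟨a₂, ha₂, hnear₂⟩ := hvis p₂ hp₂i₀
    obtain ⟨γ, hγ, p₃, hp₃, hnear₃⟩ := h.near_of_isVisit hL.reduce hL.nonneg' hL.hole hδ hδB i₀
      (ha₂.mul_stab hs'stab)
    obtain ⟨m, hm⟩ := exists_lin_of_mem_genGroup hγ
    rw [rhoZ_mul, rhoZ_mul, hm] at hnear₃
    obtain ⟨m', -, hex⟩ := h.near.exact (Y := 2 * n) (by positivity) hL.exact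
      (fun i => ((p₃ i : ℕ) : ℤ) - ((p₂ i : ℕ) : ℤ) + (((p₀ i : ℕ) : ℤ) - ((p₁ i : ℕ) : ℤ))) m
      (fun i => by
        have := hval p₀ i
        have := hval p₁ i
        have := hval p₂ i
        have := hval p₃ i
        rw [abs_le]
        constructor <;> linarith)
      (fun i => by
        have h1 := abs_le.mp (hnear₂ i)
        have h2 := abs_le.mp (hnear₃ i)
        have h3 := abs_le.mp (hshift i)
        simp only [Pi.add_apply] at h2
        have h4 : |k * (((p₃ i : ℕ) : ℤ) - ((p₂ i : ℕ) : ℤ) +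
            (((p₀ i : ℕ) : ℤ) - ((p₁ i : ℕ) : ℤ))) + lin (fun l => rhoZ (b l)) m i| * 2 ≤ k := by
          rw [← abs_two, ← abs_mul, abs_le]
          constructor <;> linarith
        linarith)
    have e0 := hex i₀
    have e1 := hex i₁
    rw [hp₃, hp₂i₀, hp₀', hp₁] at e0
    rw [hp₂i₁, hce] at e1
    have e2 : ((p₃ i₁ : ℕ) : ℤ) - n = (n + 1) * (m' i₁ - m' i₀ - e) := by linarith
    have h3 := hval p₃ i₁
    have e3 : m' i₁ - m' i₀ - e = 0 := by
      have h4 : m' i₁ - m' i₀ - e < 1 := by nlinarith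
      have h5 : -1 < m' i₁ - m' i₀ - e := by nlinarith
      omega
    rw [e3, mul_zero] at e2
    exact hi (p₃.injective (Fin.ext (by rw [hp₃, Fin.val_last]; omega)))
  refine ⟨γ₀, hγ₀, h.rhoZ_eq_zero_of_small hL.rigid hL.nonneg hs'stab fun i => ?_⟩
  have h1 := (abs_le.mp (hshift i)).2
  rw [hpeq, sub_self, mul_zero, mul_zero, sub_zero] at h1
  have hk0 : 0 ≤ k := le_trans (by positivity) hL.reduce
  linarith

/-- The product of the absolute values is one, so a bound from above on the entries is also a bound
from below, with exponent multiplied by `n`. -/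
lemma abs_rhoZ_le_of_supNorm_le {a : A1 F (n + 1)} {C : ℕ} (hn : 1 ≤ n)
    (ha : supNorm (entry a) ≤ (Fintype.card F : ℝ) ^ C) (i : Fin (n + 1)) :
    |rhoZ a i| ≤ n * C := by
  have hq := one_lt_card_real (F := F)
  have hup : ∀ i, rhoZ a i ≤ C := by
    intro i
    have h1 := (absK_le_supNorm (entry a) i).trans ha
    rw [absK_entry, ← zpow_natCast] at h1
    exact (zpow_le_zpow_iff_right₀ hq).mp h1
  have hsum := sum_rhoZ a
  rw [Fin.sum_univ_succAbove _ i] at hsum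
  have h2 := Finset.sum_le_card_nsmul Finset.univ (fun j => rhoZ a (i.succAbove j)) C
    (fun j _ => hup _)
  simp only [Finset.card_univ, Fintype.card_fin, nsmul_eq_mul] at h2
  have h3 := hup i
  have h4 : (C : ℤ) ≤ n * C := le_mul_of_one_le_left (by positivity) (by exact_mod_cast hn)
  rw [abs_le]
  constructor <;> linarith

/-- A chain of visits stays near the same deep hole. -/
lemma TightData.eq_of_equivVisit (h : TightData k E B₀ g b v) (hL : Large n k E B₀ B)
    (hn : 1 ≤ n) (hδ : 0 < δ) (hδB : (Fintype.card F : ℝ) ^ (B₀ - B) ≤ δ ^ 2) {D : ℤ}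
    (hD : 8 * D ≤ k) (hRD : holeRadius n E B ≤ D)
    (hstab : ∀ s ∈ stab (QuotientGroup.mk g : LatSpace F (n + 1)),
      ∃ γ ∈ genGroup b, rhoZ (s * γ) = 0)
    {a a' : A1 F (n + 1)} {p p' : Equiv.Perm (Fin (n + 1))} (hp : p i₀ = Fin.last n)
    (hp' : p' i₀ = Fin.last n) (ha : Near k (rhoZ a) p D) (ha' : Near k (rhoZ a') p' D)
    (heq : EquivVisit δ (QuotientGroup.mk g : LatSpace F (n + 1)) a a') : p = p' := by
  have hE := h.near.nonneg
  -- Chains are given by points of the orbit, not by elements of `A₁`. The description of the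
  -- stabilizer lifts an equality of points to one of vectors modulo `ρ(Γ_Φ)`.
  have hsame : ∀ a₁ a₂ : A1 F (n + 1), a₁ • (QuotientGroup.mk g : LatSpace F (n + 1)) =
      a₂ • (QuotientGroup.mk g : LatSpace F (n + 1)) →
      ∃ γ ∈ genGroup b, rhoZ a₂ = rhoZ a₁ + rhoZ γ := by
    intro a₁ a₂ h12
    obtain ⟨γ, hγ, h0⟩ := hstab (a₁⁻¹ * a₂) (by
      rw [MulAction.mem_stabilizer_iff, mul_smul, ← h12, inv_smul_smul])
    refine ⟨γ⁻¹, inv_mem hγ, ?_⟩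
    rw [rhoZ_mul, rhoZ_mul, rhoZ_inv] at h0
    rw [rhoZ_inv]
    ext i
    have := congrFun h0 i
    simp only [Pi.add_apply, Pi.neg_apply, Pi.zero_apply] at this ⊢
    linarith
  obtain ⟨m, c, hc0, hcm, hcv, hstep⟩ := heq
  have hk0 : 0 ≤ k := le_trans (by positivity) hL.reduce
  -- Along the chain: a step moves `ρ` by at most `n` in each coordinate, the new point is again
  -- near some hole, and holes of different classes are too far apart for this to be another one.
  -- The error does not accumulate, since each visit is again within the fixed radius `holeRadius n
  -- E B`.
  have key : ∀ i ≤ m, ∃ γ ∈ genGroup b, Near k (rhoZ (c i) + rhoZ γ) p D := by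
    intro i
    induction i with
    | zero =>
      intro _
      obtain ⟨γ, hγ, h0⟩ := hsame _ _ hc0
      exact ⟨γ, hγ, h0 ▸ ha⟩
    | succ i ih =>
      intro him
      obtain ⟨γ, hγ, hnear⟩ := ih (by omega)
      obtain ⟨e, he, γ₁, hγ₁, hγ₁e⟩ : ∃ e : Fin (n + 1) → ℤ, (∀ j, |e j| ≤ n) ∧
          ∃ γ₁ ∈ genGroup b, rhoZ (c (i + 1)) = rhoZ (c i) + e + rhoZ γ₁ := by
        obtain ⟨β, hβ, hβ'⟩ := hstep i (by omega)
        have hβn : ∀ j, |rhoZ β j| ≤ n := fun j => by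
          simpa using abs_rhoZ_le_of_supNorm_le (C := 1) hn (by simpa using hβ) j
        rcases hβ' with hβ' | hβ'
        · rw [← mul_smul] at hβ'
          obtain ⟨γ₁, hγ₁, h1⟩ := hsame _ _ hβ'
          exact ⟨rhoZ β, hβn, γ₁, hγ₁, by
            rw [h1, rhoZ_mul, add_comm (rhoZ β)]⟩
        · rw [← mul_smul] at hβ'
          obtain ⟨γ₁, hγ₁, h1⟩ := hsame _ _ hβ'
          refine ⟨-rhoZ β, fun j => ?_, γ₁⁻¹, inv_mem hγ₁, ?_⟩
          · rw [Pi.neg_apply, abs_neg]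
            exact hβn j
          · rw [rhoZ_inv, h1, rhoZ_mul]
            abel
      obtain ⟨γ₂, hγ₂, p₂, hp₂, hnear₂⟩ := h.near_of_isVisit hL.reduce hL.nonneg' hL.hole hδ hδB
        i₀ (hcv (i + 1) him)
      obtain ⟨m₂, hm₂⟩ := exists_lin_of_mem_genGroup (mul_mem (mul_mem hγ₂ hγ₁) (inv_mem hγ))
      have hnear' : Near k (rhoZ (c i) + rhoZ γ + e) p (D + 2 * n) := by
        intro j
        have h1 := abs_le.mp (hnear j)
        have h2 := abs_le.mp (he j)
        rw [abs_le]
        simp only [Pi.add_apply] at h1 ⊢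
        constructor <;> linarith
      have hpp := (h.near.separate (hL.separate hE) (hp.trans hp₂.symm) hnear' hnear₂ (m := m₂) (by
        rw [← hm₂, rhoZ_mul, rhoZ_mul, rhoZ_mul, rhoZ_inv, hγ₁e]
        abel) (by have := hL.dim; linarith)).1
      refine ⟨γ₂, hγ₂, ?_⟩
      rw [← rhoZ_mul, hpp]
      exact hnear₂.mono hRD
  obtain ⟨γ, hγ, hnear⟩ := key m le_rfl
  obtain ⟨γ', hγ', h'⟩ := hsame _ _ hcm
  obtain ⟨m₂, hm₂⟩ := exists_lin_of_mem_genGroup (mul_mem hγ' (inv_mem hγ))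
  exact (h.near.separate (hL.separate hE) (hp.trans hp'.symm) hnear ha' (m := m₂) (by
    rw [← hm₂, rhoZ_mul, rhoZ_inv, h']
    abel) (by linarith)).1

/-- The covolume of the stabilizer is at most a constant times `k ^ n`. -/
lemma TightData.covol_le (h : TightData k E B₀ g b v) (hk : 8 * (n + 3) * (E + 1) ≤ k) :
    (covol (QuotientGroup.mk g : LatSpace F (n + 1)) : ℝ) ≤ (2 * ((n : ℝ) + 1) ^ 2 * k) ^ n := by
  have hE := h.near.nonneg
  have hnE : 0 ≤ (n : ℤ) * E := by positivity
  have hk0 : 0 < k := lt_of_lt_of_le (by positivity) hk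
  have hred : ∀ a : A1 F (n + 1), ∃ γ ∈ genGroup b, ∀ i, rhoZ (a * γ) i ≤ (n + 1) * k := by
    intro a
    obtain ⟨m, hm⟩ := h.near.reduce hk (rhoZ a) (sum_rhoZ a)
    obtain ⟨γ, hγ, hγm⟩ := exists_mem_genGroup_lin b m
    refine ⟨γ, hγ, fun i => ?_⟩
    have h1 := hm i
    rw [← hγm, ← rhoZ_mul] at h1
    have : 0 ≤ n * k := by positivity
    linarith
  choose γ hγ hγle using hred
  have hlow : ∀ a i, -(n * ((n + 1) * k)) ≤ rhoZ (a * γ a) i := by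
    intro a i
    have hsum := sum_rhoZ (a * γ a)
    rw [Fin.sum_univ_succAbove _ i] at hsum
    have := Finset.sum_le_card_nsmul Finset.univ
      (fun j => rhoZ (a * γ a) (i.succAbove j)) _ (fun j _ => hγle a _)
    simp only [Finset.card_univ, Fintype.card_fin, nsmul_eq_mul] at this
    linarith
  let I := Finset.Icc (-(n * ((n + 1) * k))) ((n + 1) * k)
  -- The reduced representatives have coordinates in an interval of length `(n+1)² k`, and `n`
  -- coordinates determine the last, whence the power `k ^ n`.
  have hindex := index_le_card_of_map (genGroup b ⊔ A1U F (n + 1)) (α := Fin n → I)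
    (fun a i => ⟨rhoZ (a * γ a) i.castSucc, Finset.mem_Icc.mpr ⟨hlow a _, hγle a _⟩⟩) (by
      intro a a' haa'
      have hc : ∀ i : Fin n, rhoZ (a * γ a) i.castSucc = rhoZ (a' * γ a') i.castSucc := fun i =>
        congrArg Subtype.val (congrFun haa' i)
      have heq : rhoZ (a * γ a) = rhoZ (a' * γ a') := by
        ext i
        induction i using Fin.lastCases with
        | cast i => exact hc i
        | last =>
          have h1 := sum_rhoZ (a * γ a)
          have h2 := sum_rhoZ (a' * γ a')
          rw [Fin.sum_univ_castSucc] at h1 h2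
          rw [Finset.sum_congr rfl fun i _ => hc i] at h1
          linarith
      have hU : (a * γ a)⁻¹ * (a' * γ a') ∈ genGroup b ⊔ A1U F (n + 1) := by
        refine Subgroup.mem_sup_right (mem_A1U_iff.mpr ?_)
        rw [rhoZ_mul, rhoZ_inv, heq, neg_add_cancel]
      have hmem := mul_mem (mul_mem (Subgroup.mem_sup_left (T := A1U F (n + 1)) (hγ a)) hU)
        (Subgroup.mem_sup_left (T := A1U F (n + 1)) (inv_mem (hγ a')))
      have : γ a * ((a * γ a)⁻¹ * (a' * γ a')) * (γ a')⁻¹ = a⁻¹ * a' := by group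
      rwa [this] at hmem)
  have hfin : (genGroup b ⊔ A1U F (n + 1)).FiniteIndex := ⟨hindex.1⟩
  have hle : covol (QuotientGroup.mk g : LatSpace F (n + 1)) ≤
      (genGroup b ⊔ A1U F (n + 1)).index :=
    Subgroup.index_antitone (sup_le_sup_right h.le_stab _)
  have hcard : Fintype.card (Fin n → I) = (((n + 1) * ((n + 1) * k) + 1).toNat) ^ n := by
    rw [Fintype.card_fun, Fintype.card_fin, Fintype.card_coe, Int.card_Icc]
    congr 2
    ring
  have hcov : (covol (QuotientGroup.mk g : LatSpace F (n + 1)) : ℝ) ≤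
      ((((n + 1) * ((n + 1) * k) + 1).toNat ^ n : ℕ) : ℝ) := by
    exact_mod_cast (hle.trans hindex.2).trans hcard.le
  refine hcov.trans ?_
  push_cast
  refine pow_le_pow_left₀ (by positivity) ?_ n
  have h1 : ((((n + 1) * ((n + 1) * k) + 1).toNat : ℤ) : ℝ) =
      (n + 1) * ((n + 1) * k) + 1 := by
    rw [Int.toNat_of_nonneg (by positivity)]
    push_cast
    ring
  rw [Int.cast_natCast] at h1
  rw [h1]
  have h2 : (1 : ℝ) ≤ k := by exact_mod_cast hk0
  have h3 : (0 : ℝ) ≤ n * k := by positivity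
  have h4 : (0 : ℝ) ≤ n * (n * k) := by positivity
  nlinarith

end Structure


/-! ### Tight standard simplex sets -/

section Standard

variable {F : Type*} [Field F] [Fintype F] {n : ℕ}

lemma rhoZ_prod_ofFn {d m : ℕ} (t : Fin m → A1 F d) :
    rhoZ (List.ofFn t).prod = ∑ j, rhoZ (t j) := by
  have h := map_list_prod (rhoHom F d) (List.ofFn t)
  rw [List.map_ofFn, List.prod_ofFn] at h
  exact h

lemma rhoZ_stdVec_pow_mul (k : ℕ) (l : Fin (n + 1)) (c : A1 F (n + 1)) (i : Fin (n + 1)) :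
    rhoZ (stdVec F l ^ k * c) i =
      ((k : ℤ) - if i = l then ((n : ℤ) + 1) * k else 0) + rhoZ c i := by
  rw [rhoZ_mul, rhoZ_pow, Pi.add_apply, Pi.smul_apply, rhoZ_stdVec, nsmul_eq_mul]
  split_ifs <;> ring

lemma le_xi (t : Fin (n + 1) → A1 F (n + 1)) (l i : Fin (n + 1)) : rhoVec (t l) i ≤ xi t :=
  (le_ciSup (f := fun i => rhoVec (t l) i) (Set.finite_range _).bddAbove i).trans
    (le_ciSup (f := fun l => ceil (rhoVec (t l))) (Set.finite_range _).bddAbove l)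

/-- A standard set is given only as a set, so `π` matches its enumeration with the `b_l`; for `k > 2
n C` the `b_l` are distinct. The constant `n (n C)` is the loss from `ξ_Φ ≥ k - n C`, and `N`
absorbs `M²`. -/
lemma exists_tightData (hn : 1 ≤ n) {M : ℝ} {C N k : ℕ} (hN : M ^ 2 ≤ (Fintype.card F : ℝ) ^ N)
    (hk : 2 * (n * C) < k) {g : G F (n + 1)} {t : Fin (n + 1) → A1 F (n + 1)}
    (ht : IsTight M t (QuotientGroup.mk g)) (hs : IsStandard k C t) :
    ∃ (b : Fin (n + 1) → A1 F (n + 1)) (π : Equiv.Perm (Fin (n + 1))) (v : Fin (n + 1) → KInf F),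
      (∀ j, t j = b (π j)) ∧ genGroup t = genGroup b ∧
        TightData k (n * C) (n * (n * C) + N) g b v := by
  have hq := one_lt_card_real (F := F)
  have hq0 := card_pos' (F := F)
  obtain ⟨-, ⟨⟨-, -, hprod⟩, hstab⟩, htight⟩ := ht
  obtain ⟨c, hc, hrange⟩ := hs
  set b : Fin (n + 1) → A1 F (n + 1) := fun l => stdVec F l ^ k * c l with hb
  have hkZ : 2 * ((n : ℤ) * C) < k := by exact_mod_cast hk
  have hclose : ∀ j i, |rhoZ (b j) i - ((k : ℤ) - if i = j then ((n : ℤ) + 1) * k else 0)| ≤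
      n * C := by
    intro j i
    rw [hb]
    dsimp only
    rw [rhoZ_stdVec_pow_mul, add_sub_cancel_left]
    exact abs_rhoZ_le_of_supNorm_le hn (hc j) i
  have hinj : Function.Injective b := by
    intro l l' hll
    by_contra hne
    have h1 := (abs_le.mp (hclose l l)).2
    have h2 := (abs_le.mp (hclose l' l)).1
    rw [← hll, if_neg hne] at h2
    rw [if_pos rfl] at h1
    have h3 : 0 ≤ (n : ℤ) * k := by positivity
    linarith
  have hex : ∀ j, ∃ l, b l = t j := fun j => by
    have : t j ∈ Set.range b := hrange ▸ ⟨j, rfl⟩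
    exact this
  choose π₀ hπ₀ using hex
  have hsurj : Function.Surjective π₀ := by
    intro l
    obtain ⟨j, hj⟩ : b l ∈ Set.range t := hrange ▸ ⟨l, rfl⟩
    exact ⟨j, hinj ((hπ₀ j).trans hj)⟩
  let π : Equiv.Perm (Fin (n + 1)) :=
    Equiv.ofBijective π₀ (Finite.surjective_iff_bijective.mp hsurj)
  have htb : ∀ j, t j = b (π j) := fun j => (hπ₀ j).symm
  have hgen : genGroup t = genGroup b := by rw [genGroup, genGroup, hrange]
  obtain ⟨v, hv, hv0, hmin⟩ := exists_shortest g
  refine ⟨b, π, v, htb, hgen, ⟨hclose, fun j => sum_rhoZ (b j), fun i => ?_⟩, hgen ▸ hstab, hv, hv0,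
    hmin, ?_⟩
  · have h1 := rhoZ_prod_ofFn t
    rw [hprod, rhoZ_one] at h1
    simp only [htb] at h1
    rw [Equiv.sum_comp π fun l => rhoZ (b l)] at h1
    simpa using (congrFun h1 i).symm
  · have hxi : (k : ℝ) - n * C ≤ xi t := by
      -- Any coordinate other than the negative one is at least `k - n C`; one exists because `n ≥
      -- 1`.
      obtain ⟨i, hi⟩ : ∃ i : Fin (n + 1), i ≠ π 0 := by
        have : Nontrivial (Fin (n + 1)) := Fin.nontrivial_iff_two_le.mpr (by omega)
        exact exists_ne _
      refine le_trans ?_ (le_xi t 0 i)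
      have h1 := (abs_le.mp (hclose (π 0) i)).1
      rw [if_neg hi, ← htb, sub_zero] at h1
      rw [rhoVec_eq]
      have h2 : (k : ℤ) - n * C ≤ rhoZ (t 0) i := by linarith
      exact_mod_cast h2
    have hell : 0 ≤ ellG g := by
      have h1 := supNorm_nonneg v
      rw [ellG_eq hv hv0 hmin] at h1
      exact nonneg_of_mul_nonneg_left h1 (Real.rpow_pos_of_pos (absK_det_pos g) _)
    have h1 : ellG g ^ 2 ≤ M ^ 2 * (Fintype.card F : ℝ) ^ (-((n : ℝ) * (k - n * C))) := by
      refine (pow_le_pow_left₀ hell (show ellG g ≤ _ from htight) 2).trans ?_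
      rw [mul_pow, ← Real.rpow_natCast (_ ^ _), ← Real.rpow_mul hq0.le]
      refine mul_le_mul_of_nonneg_left (Real.rpow_le_rpow_of_exponent_le hq.le ?_) (sq_nonneg M)
      push_cast
      have := mul_le_mul_of_nonneg_left hxi (Nat.cast_nonneg (α := ℝ) n)
      linarith
    calc ellG g ^ 2 * (Fintype.card F : ℝ) ^ ((n : ℤ) * k - (n * (n * C) + N))
        ≤ (Fintype.card F : ℝ) ^ N * (Fintype.card F : ℝ) ^ (-((n : ℝ) * (k - n * C))) *
            (Fintype.card F : ℝ) ^ ((n : ℤ) * k - (n * (n * C) + N)) :=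
          mul_le_mul_of_nonneg_right (h1.trans (mul_le_mul_of_nonneg_right hN
            (Real.rpow_nonneg hq0.le _))) (zpow_nonneg hq0.le _)
      _ = 1 := by
          rw [← Real.rpow_natCast, ← Real.rpow_intCast, ← Real.rpow_add hq0, ← Real.rpow_add hq0]
          push_cast
          ring_nf
          exact Real.rpow_zero _

lemma radius_le {k E B₀ : ℤ} {g : G F (n + 1)} {b : Fin (n + 1) → A1 F (n + 1)}
    {v : Fin (n + 1) → KInf F} (h : TightData k E B₀ g b v) (hk : 8 * (n + 3) * (E + 1) ≤ k)
    (hn : 1 ≤ n) {c κ : ℝ} (hc : 0 < c) (hκ : 0 < κ) :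
    radius c κ (QuotientGroup.mk g : LatSpace F (n + 1)) ≤
      c * (2 * ((n : ℝ) + 1) ^ 2 * k) ^ κ := by
  have hE := h.near.nonneg
  have hk0 : (0 : ℝ) ≤ k := by
    have : 0 ≤ k := le_trans (by positivity) hk
    exact_mod_cast this
  refine mul_le_mul_of_nonneg_left ?_ hc.le
  refine (Real.rpow_le_rpow (Nat.cast_nonneg _) (h.covol_le hk) (by positivity)).trans
    (le_of_eq ?_)
  rw [← Real.rpow_natCast, ← Real.rpow_mul (by positivity)]
  congr 1
  have : (n : ℝ) ≠ 0 := by positivity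
  field_simp

/-- The radius `r` is eventually small compared to `k`. -/
lemma eventually_radius_small {c κ : ℝ} (hκ1 : κ < 1) (A K : ℝ) (hA : 0 ≤ A) :
    ∀ᶠ k : ℕ in Filter.atTop, 8 * (c * (A * k) ^ κ + K) ≤ k := by
  have h1 : Filter.Tendsto (fun k : ℕ => (8 * c * A ^ κ) * (k : ℝ) ^ (-(1 - κ))) Filter.atTop
      (nhds ((8 * c * A ^ κ) * 0)) :=
    ((tendsto_rpow_neg_atTop (sub_pos.mpr hκ1)).comp tendsto_natCast_atTop_atTop).const_mul _
  rw [mul_zero] at h1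
  have h2 := h1.eventually_le_const (show (0 : ℝ) < 1 / 2 by norm_num)
  have h3 := (tendsto_natCast_atTop_atTop (R := ℝ)).eventually_ge_atTop (16 * K)
  filter_upwards [h2, h3, Filter.eventually_gt_atTop 0] with k h2 h3 hk
  have hk' : (0 : ℝ) < k := by exact_mod_cast hk
  have h4 : (A * k) ^ κ = A ^ κ * ((k : ℝ) ^ (-(1 - κ)) * k) := by
    rw [Real.mul_rpow hA hk'.le]
    congr 1
    conv_rhs => rw [← Real.rpow_one (k : ℝ), ← Real.rpow_mul hk'.le, ← Real.rpow_add hk']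
    congr 1
    ring
  rw [h4]
  have h5 := mul_le_mul_of_nonneg_right h2 hk'.le
  linarith

lemma eventually_large (n : ℕ) (E B₀ B : ℤ) (hB₀ : 0 ≤ B₀) (hB : 0 ≤ B) :
    ∀ᶠ k : ℕ in Filter.atTop, Large n k E B₀ B := by
  have h := fun K : ℤ => (tendsto_natCast_atTop_atTop (R := ℤ)).eventually_ge_atTop K
  filter_upwards [h (8 * (n + 3) * (E + 1)), h (B + 2 * (E * (n + 1)) + 1),
    h (2 * (E * (n + 1) * (n + 1)) + (n + 1) * B₀ + 1),
    h (2 * (2 * (2 * n) + 1) * E + 2 * E + 1), h (8 * holeRadius n E B), h (4 * n)]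
    with k h1 h2 h3 h4 h5 h6
  exact ⟨hB₀, hB, h1, h2, h3, h4, h5, h6⟩

end Standard

end FuncLattice

/-! ### Choice of constants and proof of the theorem -/

open FuncLattice
theorem mainTheorem8 {F : Type*} [Field F] [Fintype F] (n : ℕ) (hn : 1 ≤ n)
    (M : ℝ) (hM : 0 < M) (C : ℕ) (c : ℝ) (hc : 0 < c)
    (κ : ℝ) (hκ0 : 0 < κ) (hκ1 : κ < 1) (δ : ℝ) (hδ0 : 0 < δ) (hδ1 : δ < 1) :
    ∃ k₀ : ℕ, ∀ k ≥ k₀, ∀ (x : LatSpace F (n + 1)) (t : Fin (n + 1) → A1 F (n + 1)),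
      IsTight M t x → IsStandard k C t →
        (((genGroup t).map (projA1 F (n + 1))).relIndex
              ((stab x).map (projA1 F (n + 1))) ≠ 0 ∧
          ((genGroup t).map (projA1 F (n + 1))).relIndex
              ((stab x).map (projA1 F (n + 1))) ≤ n.factorial) ∧
        (WVisited c κ δ t x = WSet t →
          (stab x : Set (A1 F (n + 1))) * (A1U F (n + 1) : Set (A1 F (n + 1))) =
            (genGroup t : Set (A1 F (n + 1))) * (A1U F (n + 1) : Set (A1 F (n + 1)))) ∧
        (WVisited c κ δ t x = WSet t →
          ∃ T : Finset (A1 F (n + 1)), T.card = n.factorial ∧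
            (∀ a ∈ T, IsVisit δ x a) ∧
            ∀ a ∈ T, ∀ b ∈ T, a ≠ b → ¬ EquivVisit δ x a b) := by
  classical
  have hq := one_lt_card_real (F := F)
  have hq0 := card_pos' (F := F)
  obtain ⟨N, hN⟩ := pow_unbounded_of_one_lt (M ^ 2) hq
  obtain ⟨N', hN'⟩ := pow_unbounded_of_one_lt ((δ ^ 2)⁻¹) hq
  set E : ℤ := n * C with hE
  set B₀ : ℤ := n * (n * C) + N with hB₀
  -- `N'` makes the description of visits valid at depth `δ`, and `2 (n+1)²` at the depth
  -- `q^(-(n+1)²)` of the visit behind the index bound.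
  set B : ℤ := B₀ + N' + 2 * (n + 1) ^ 2 with hB
  have hB₀0 : 0 ≤ B₀ := by positivity
  have hB0 : 0 ≤ B := by positivity
  have hδB : (Fintype.card F : ℝ) ^ (B₀ - B) ≤ δ ^ 2 := by
    refine (zpow_le_zpow_right₀ hq.le (show B₀ - B ≤ -(N' : ℤ) by
      have : (0 : ℤ) ≤ 2 * (n + 1) ^ 2 := by positivity
      linarith)).trans ?_
    rw [zpow_neg, zpow_natCast]
    exact inv_le_of_inv_le₀ (by positivity) hN'.le
  obtain ⟨k₀, hk₀⟩ := Filter.eventually_atTop.mp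
    (((eventually_large n E B₀ B hB₀0 hB0).and (Filter.eventually_gt_atTop (2 * (n * C)))).and
      (eventually_radius_small (c := 2 * n * c) hκ1 (2 * ((n : ℝ) + 1) ^ 2)
        (1 + n * E + holeRadius n E B) (by positivity)))
  refine ⟨k₀, fun k hk x t ht hs => ?_⟩
  obtain ⟨⟨hL, hkC⟩, hkr⟩ := hk₀ k hk
  obtain ⟨g, rfl⟩ := QuotientGroup.mk_surjective x
  obtain ⟨b, π, v, htb, hgen, hdata⟩ := exists_tightData hn hN.le hkC ht hs
  rw [hgen]
  set r := radius c κ (QuotientGroup.mk g : LatSpace F (n + 1)) with hr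
  have hr0 : 0 ≤ r := mul_nonneg hc.le (Real.rpow_nonneg (Nat.cast_nonneg _) _)
  have hrle : r ≤ c * (2 * ((n : ℝ) + 1) ^ 2 * k) ^ κ := by
    simpa using radius_le hdata hL.reduce hn hc hκ0
  -- One tolerance for the visits near the `w_τ` and for arbitrary visits near holes; since `κ < 1`,
  -- it is eventually at most `k/8`.
  set D : ℤ := ⌈2 * n * r⌉ + n * E + holeRadius n E B with hD
  have hR0 : 0 ≤ holeRadius n E B := by
    have : 0 ≤ E := by positivity
    unfold holeRadius
    positivity
  have hDk : 8 * D ≤ k := by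
    have h1 := (Int.ceil_lt_add_one (2 * n * r)).le
    have h2 : 2 * n * r ≤ 2 * n * c * (2 * ((n : ℝ) + 1) ^ 2 * k) ^ κ := by
      have := mul_le_mul_of_nonneg_left hrle (by positivity : (0 : ℝ) ≤ 2 * n)
      linarith
    have h3 : (8 * D : ℝ) ≤ k := by
      rw [hD]
      push_cast
      linarith
    exact_mod_cast h3
  have hRD : holeRadius n E B ≤ D := by
    have h1 : 0 ≤ ⌈2 * n * r⌉ := Int.ceil_nonneg (by positivity)
    have h2 : 0 ≤ n * E := by positivity
    linarith
  have hDr : 2 * n * r + n * E ≤ D := by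
    have h1 := Int.le_ceil (2 * n * r)
    have h2 : (0 : ℝ) ≤ holeRadius n E B := by exact_mod_cast hR0
    rw [hD]
    push_cast
    linarith
  have hvisit : WVisited c κ δ t (QuotientGroup.mk g : LatSpace F (n + 1)) = WSet t →
      ∀ τ, ∃ a : A1 F (n + 1), IsVisit δ (QuotientGroup.mk g : LatSpace F (n + 1)) a ∧
        Near k (rhoZ a) (holePerm π τ) D := by
    intro hW τ
    have hmem : wVec t τ ∈ WVisited c κ δ t (QuotientGroup.mk g : LatSpace F (n + 1)) :=
      hW ▸ ⟨τ, rfl⟩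
    obtain ⟨-, a, ha, hav⟩ := hmem
    exact ⟨a, hav, near_of_mem_rhoBall hn htb hdata.near τ hr0 ha hDr⟩
  have hstab : WVisited c κ δ t (QuotientGroup.mk g : LatSpace F (n + 1)) = WSet t →
      ∀ s ∈ stab (QuotientGroup.mk g : LatSpace F (n + 1)), ∃ γ ∈ genGroup b, rhoZ (s * γ) = 0 := by
    intro hW s hs
    refine hdata.exists_mul_rhoZ_eq_zero (i₀ := π (Fin.last n)) hL hδ0 hδB hDk (fun p hp => ?_) hs
    obtain ⟨τ, rfl⟩ := exists_holePerm_eq π p hp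
    exact hvisit hW τ
  refine ⟨hdata.relIndex_le hL (by
    have : (0 : ℤ) ≤ N' := by positivity
    linarith), fun hW => ?_, fun hW => ?_⟩
  · refine subset_antisymm ?_ (Set.mul_subset_mul_right hdata.le_stab)
    rintro _ ⟨s, hs, u, hu, rfl⟩
    obtain ⟨γ, hγ, h0⟩ := hstab hW s hs
    refine ⟨γ⁻¹, inv_mem hγ, s * γ * u, mul_mem (mem_A1U_iff.mpr h0) hu, ?_⟩
    dsimp only
    rw [A1.mul_comm' s γ, mul_assoc, inv_mul_cancel_left]
  · choose a hav han using hvisit hW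
    have hsep : ∀ τ τ', EquivVisit δ (QuotientGroup.mk g : LatSpace F (n + 1)) (a τ) (a τ') →
        τ = τ' := fun τ τ' h => holePerm_injective π
      (hdata.eq_of_equivVisit hL hn hδ0 hδB hDk hRD (hstab hW) (holePerm_last π τ)
        (holePerm_last π τ') (han τ) (han τ') h)
    -- Equal visit times are equivalent by the chain of length zero, so inequivalence already makes
    -- the `n!` chosen times distinct.
    have hinj : Function.Injective a := fun τ τ' h => hsep τ τ'
      ⟨0, fun _ => a τ, rfl, by rw [h], fun _ _ => hav τ, fun i hi => absurd hi (Nat.not_lt_zero i)⟩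
    refine ⟨Finset.univ.image a, ?_, fun y hy => ?_, fun y hy y' hy' hne heq => ?_⟩
    · rw [Finset.card_image_of_injective _ hinj, Finset.card_univ, Fintype.card_perm,
        Fintype.card_fin]
    · obtain ⟨τ, -, rfl⟩ := Finset.mem_image.mp hy
      exact hav τ
    · obtain ⟨τ, -, rfl⟩ := Finset.mem_image.mp hy
      obtain ⟨τ', -, rfl⟩ := Finset.mem_image.mp hy'
      exact hne (congrArg a (hsep τ τ' heq))
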